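/- Let $M=2^n$ with $n=\log_2 M\ge 1$, and consider the complete binary tree whose leaves are $M$ processes, exactly one of which (the target) is anomalous, process $m$ being the target with prior probability $\pi_m$. Leaves are on level $0$, the root is on level $\log_2M$. Probing a node on level $l$ yields an independent observation with law $g_l=\mathrm{Ber}(1-\mu_l)$ if the subtree of the node contains the target and with law $f_l=\mathrm{Ber}(\mu_l)$ otherwise, where $$\mu_l=\tfrac12-\left(\tfrac12-\mu_0\right)(l+1)^{-\alpha},\qquad \alpha\in\{1,2,\dots\},\quad 0<\mu_0<\tfrac12 .$$ For a cost $c\in(0,1)$ per observation, the information-directed random walk (IRW) is the following search strategy. It starts at the root. At a node of level $l\ge1$ it takes $K_l$ samples from each of the two children and computes, for each child, the sum log-likelihood ratio $\sum_{i=1}^{K_l}\log\frac{g_{l-1}(y_i)}{f_{l-1}(y_i)}$; if both sums are negative, it moves to the parent (the parent of the root being the root), otherwise to the child with the larger sum (ties are broken by an arbitrary fixed rule). At a leaf it takes samples one by one and updates the sum log-likelihood ratio of the current visit (with $g_0,f_0$); when the sum becomes negative it moves to the parent, and when the sum exceeds $\log\frac{\log_2M}{c}$ it stops and declares this leaf to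 be the target. Let $\tau$ be the total number of samples, $\delta$ the declared leaf, and $$Q=\sum_m\pi_m\mathbb E[\tau\mid H_m],\qquad R=\sum_m\pi_m\Pr[\delta\ne m\mid H_m]+c\,Q ,$$ where $H_m$ is the hypothesis that $m$ is the target; $R$ is the Bayes risk and $Q$ the sample complexity. Let $p_l^{(g)}(k)=\Pr\big[\sum_{i\le k}\log\frac{g_{l-1}(Y_i)}{f_{l-1}(Y_i)}>\max\{\sum_{i\le k}\log\frac{g_{l-1}(Z_i)}{f_{l-1}(Z_i)},0\}\big]$ and $p_l^{(f)}(k)=\Pr\big[\sum_{i\le k}\log\frac{g_{l-1}(Z_i)}{f_{l-1}(Z_i)}<0\big]^2$, with $Y_i\sim g_{l-1}$ and $Z_i\sim f_{l-1}$ all independent. A sample size $k$ has confidence level $p$ on level $l$ if $p_l^{(g)}(k)>p$ and $p_l^{(f)}(k)>p$. For $p\in(\frac12,1)$ let $K_l^{\min}(p)$ be the least sample size of confidence level $p$ on level $l$, and for $\eta\in(\frac1{\sqrt2},1)$ let $K_l^{\rm ex}(\eta)=\left\lceil \frac{12(1-\mu_{l-1})\log\frac1{1-\eta}}{(1-2\mu_{l-1})^2}\right\rceil$.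 Then: 1. $K_l^{\min}(p)$ exists for all $l\ge1$ and $p\in(\frac12,1)$, and $K_l^{\rm ex}(\eta)$ has confidence level $\eta^2>\frac12$ on every level $l\ge1$, for all $\eta\in(\frac1{\sqrt2},1)$. 2. For all $p\in(\frac12,1)$, $\eta\in(\frac1{\sqrt2},1)$ and $A\in\mathbb N$ there are constants $B_1,B_2$, depending only on $\alpha,\mu_0,p,\eta,A$, such that for all $n\ge 1$ and $M=2^n$, all $c\in(0,1)$, all priors, all tie-breaking rules and all sample sizes $K_l$ $(1\le l\le\log_2M)$ that have confidence level $p$ and satisfy $K_l\le A\max\{K_l^{\min}(p),K_l^{\rm ex}(\eta)\}$ (in particular for $K_l=K_l^{\min}(p)$, and, if $p=\eta^2$, for $K_l=K_l^{\rm ex}(\eta)$), the Bayes risk of IRW satisfies $$R\le B_1\,c\,(\log_2M)^{2\alpha+1}+\frac{c\log\frac{\log_2M}{c}}{D(g_0\|f_0)}+B_2\,c ,$$ where $D$ is the Kullback–Leibler divergence. 3. For the same strategies and every fixed $c\in(0,1)$, the sample complexity is polylogarithmic in $M$: $Q\le C(\log_2M)^{2\alpha+1}$ with $C$ depending only on $c,\alpha,\mu_0,p,\eta,A$.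 -/

import Mathlib

open MeasureTheory ProbabilityTheory
open scoped ENNReal

noncomputable section

namespace TreeSearch

/-! ### The binary tree with `M = 2 ^ n` leaves -/

/-- A node of the complete binary tree of depth `n`: the sequence of left (`true`) / right (`false`)
turns on the path from the root, the most recent turn first.  The root is `[]`. -/
abbrev Node (n : ℕ) : Type := {v : List Bool // v.length ≤ n}

/-- The leaves, i.e. the `2 ^ n` processes. -/
abbrev Leaf (n : ℕ) : Type := List.Vector Bool n

variable {n : ℕ}

/-- The level of a node: leaves are on level `0`, the root is on level `n = log₂ M`. -/
def Node.level (v : Node n) : ℕ := n - v.1.length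

def Node.root : Node n := ⟨[], Nat.zero_le n⟩

/-- The parent of a node; the parent of the root is the root itself. -/
def Node.parent (v : Node n) : Node n :=
  ⟨v.1.tail, by have h := v.2; rw [List.length_tail]; omega⟩

/-- The left (`b = true`) or right (`b = false`) child of a node that is not a leaf. -/
def Node.child (v : Node n) (b : Bool) : Node n :=
  if h : v.1.length < n then ⟨b :: v.1, h⟩ else v

/-- Leaf `m` belongs to the subtree rooted at `v`. -/
def Node.Contains (v : Node n) (m : Leaf n) : Prop := v.1 <:+ m.toList

/-! ### Bernoulli observations -/

/-- Law of an observation of a level-`l` node that does not contain the target: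
Bernoulli with parameter `μ l`. -/
def absentLaw (μ : ℕ → unitInterval) (l : ℕ) : Measure Bool :=
  bernoulliMeasure true false (μ l)

/-- Law of an observation of a level-`l` node that contains the target:
Bernoulli with parameter `1 - μ l`. -/
def presentLaw (μ : ℕ → unitInterval) (l : ℕ) : Measure Bool :=
  bernoulliMeasure true false (unitInterval.symm (μ l))

/-- Log-likelihood ratio `log (g_l(y) / f_l(y))` of a level-`l` observation `y`. -/
def logLR (μ : ℕ → unitInterval) (l : ℕ) (y : Bool) : ℝ :=
  Real.log ((presentLaw μ l).real {y} / (absentLaw μ l).real {y})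

open scoped Classical in
/-- Law of an observation of node `v` when leaf `m` is the target. -/
def obsLaw (μ : ℕ → unitInterval) (m : Leaf n) (v : Node n) : Measure Bool :=
  if v.Contains m then presentLaw μ v.level else absentLaw μ v.level

/-- Probability space under the hypothesis that leaf `m` is the target: `ω t v` is the value that is
seen if node `v` is probed at time `t`; all these values are independent. -/
def hypMeasure (μ : ℕ → unitInterval) (m : Leaf n) : Measure (ℕ → Node n → Bool) :=
  Measure.infinitePi fun _ : ℕ => Measure.infinitePi fun v : Node n => obsLaw μ m v

/-! ### Search strategies and their risk -/

/-- An active search strategy: given the list of the observations so far (oldest first), either probe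
a node next (`Sum.inl`) or stop and declare a leaf to be the target (`Sum.inr`). -/
abbrev Strategy (n : ℕ) : Type := List Bool → Node n ⊕ Leaf n

namespace Strategy

/-- The observations made up to time `t`; nothing is added after stopping. -/
def history (Γ : Strategy n) (ω : ℕ → Node n → Bool) : ℕ → List Bool
  | 0 => []
  | t + 1 =>
    match Γ (Γ.history ω t) with
    | Sum.inl v => Γ.history ω t ++ [ω t v]
    | Sum.inr _ => Γ.history ω t

/-- The number of observations taken before stopping (`⊤` if the strategy never stops). -/
def stopTime (Γ : Strategy n) (ω : ℕ → Node n → Bool) : ℝ≥0∞ :=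
  ⨅ (t : ℕ) (_ : (Γ (Γ.history ω t)).isRight), (t : ℝ≥0∞)

/-- The strategy stops at some time and declares leaf `m`. -/
def Declares (Γ : Strategy n) (m : Leaf n) (ω : ℕ → Node n → Bool) : Prop :=
  ∃ t : ℕ, Γ (Γ.history ω t) = Sum.inr m

/-- Probability of detection error under the prior `π`
(a run that never stops counts as an error). -/
def errorProb (Γ : Strategy n) (μ : ℕ → unitInterval) (π : PMF (Leaf n)) : ℝ≥0∞ :=
  ∑ m, π m * hypMeasure μ m {ω | ¬ Γ.Declares m ω}

/-- Sample complexity: expected number of observations under the prior `π`. -/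
def sampleComplexity (Γ : Strategy n) (μ : ℕ → unitInterval) (π : PMF (Leaf n)) : ℝ≥0∞ :=
  ∑ m, π m * ∫⁻ ω, Γ.stopTime ω ∂(hypMeasure μ m)

/-- Bayes risk with cost `c` per observation and loss `1` for a wrong declaration. -/
def bayesRisk (Γ : Strategy n) (μ : ℕ → unitInterval) (π : PMF (Leaf n)) (c : ℝ) : ℝ≥0∞ :=
  Γ.errorProb μ π + ENNReal.ofReal c * Γ.sampleComplexity μ π

end Strategy

/-! ### The sample sizes of the local test -/

/-- `p_l^{(g)}`: probability that the fixed-size local test with `k` samples per child, on a level-`l`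
node that contains the target, moves the walk closer to the target. -/
def confPresent (μ : ℕ → unitInterval) (l k : ℕ) : ℝ :=
  ((Measure.pi fun _ : Fin k => presentLaw μ (l - 1)).prod
      (Measure.pi fun _ : Fin k => absentLaw μ (l - 1))).real
    {w | max (∑ i, logLR μ (l - 1) (w.2 i)) 0 < ∑ i, logLR μ (l - 1) (w.1 i)}

/-- `p_l^{(f)}`: the same for a level-`l` node that does not contain the target. -/
def confAbsent (μ : ℕ → unitInterval) (l k : ℕ) : ℝ :=
  ((Measure.pi fun _ : Fin k => absentLaw μ (l - 1)).real
    {z | ∑ i, logLR μ (l - 1) (z i) < 0}) ^ 2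

/-- With `k` samples per child, the local test on level `l` has confidence level `p`. -/
def MeetsConfidence (μ : ℕ → unitInterval) (p : ℝ) (l k : ℕ) : Prop :=
  p < confPresent μ l k ∧ p < confAbsent μ l k

/-- The least sample size with which the local test on level `l` has confidence level `p`. -/
def minSampleSize (μ : ℕ → unitInterval) (p : ℝ) (l : ℕ) : ℕ :=
  sInf {k | MeetsConfidence μ p l k}

/-- The closed-form sample size
`⌈12 (1 - μ_{l-1}) log (1 / (1 - η)) / (1 - 2 μ_{l-1})²⌉`. -/
def explicitSampleSize (μ : ℕ → unitInterval) (η : ℝ) (l : ℕ) : ℕ :=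
  ⌈12 * (1 - (μ (l - 1) : ℝ)) * Real.log (1 / (1 - η)) / (1 - 2 * (μ (l - 1) : ℝ)) ^ 2⌉₊

/-- `K` is a choice of sample sizes for the levels `1, …, n`: the local tests have confidence level `p`,
and the sizes are at most `A` times the larger of the least possible and the closed-form one. -/
def IsSampleRule (μ : ℕ → unitInterval) (p η : ℝ) (A n : ℕ) (K : ℕ → ℕ) : Prop :=
  ∀ l : ℕ, 1 ≤ l → l ≤ n →
    MeetsConfidence μ p l (K l) ∧
      K l ≤ A * max (minSampleSize μ p l) (explicitSampleSize μ η l)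

/-! ### The information-directed random walk (IRW) -/

/-- State of the walk: the current node; the number of samples taken during the current visit; and
the sum log-likelihood ratios accumulated during the current visit.  On an upper-level node `sumL` and
`sumR` belong to the left and right child; on a leaf only `sumL` is used, for the leaf itself. -/
structure IRWState (n : ℕ) where
  node : Node n
  count : ℕ
  sumL : ℝ
  sumR : ℝ

/-- The state at the beginning of a visit to `v`. -/
def IRWState.enter (v : Node n) : IRWState n := ⟨v, 0, 0, 0⟩

/-- The move after a local test at `v`: to the parent if both sums are negative, otherwise to the child
with the larger sum (to the child `tie v` if the two sums are equal). -/
def localTestMove (tie : Node n → Bool) (v : Node n) (sL sR : ℝ) : Node n :=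
  if sL < 0 ∧ sR < 0 then v.parent
  else if sR < sL then v.child true
  else if sL < sR then v.child false
  else v.child (tie v)

/-- The action of IRW: on a leaf, declare it if its sum exceeds `log (log₂ M / c)` and otherwise probe
it; on an upper-level node of level `l`, probe the left child `K l` times, then the right child `K l`
times. -/
def irwAct (K : ℕ → ℕ) (c : ℝ) (s : IRWState n) : Node n ⊕ Leaf n :=
  if h : s.node.1.length = n then
    if Real.log ((n : ℝ) / c) < s.sumL then Sum.inr ⟨s.node.1, h⟩ else Sum.inl s.node
  else if s.count < K s.node.level then Sum.inl (s.node.child true)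
  else Sum.inl (s.node.child false)

/-- The new state of IRW after the observation `y`. -/
def irwUpdate (μ : ℕ → unitInterval) (K : ℕ → ℕ) (tie : Node n → Bool) (s : IRWState n) (y : Bool) :
    IRWState n :=
  if s.node.1.length = n then
    if s.sumL + logLR μ 0 y < 0 then IRWState.enter s.node.parent
    else ⟨s.node, s.count + 1, s.sumL + logLR μ 0 y, 0⟩
  else if s.count < K s.node.level then
    ⟨s.node, s.count + 1, s.sumL + logLR μ (s.node.level - 1) y, s.sumR⟩
  else if s.count + 1 < 2 * K s.node.level then
    ⟨s.node, s.count + 1, s.sumL, s.sumR + logLR μ (s.node.level - 1) y⟩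
  else
    IRWState.enter
      (localTestMove tie s.node s.sumL (s.sumR + logLR μ (s.node.level - 1) y))

/-- The IRW strategy with sample sizes `K`, started at the root. -/
def irw (n : ℕ) (μ : ℕ → unitInterval) (K : ℕ → ℕ) (tie : Node n → Bool) (c : ℝ) : Strategy n :=
  fun obs => irwAct K c (obs.foldl (irwUpdate μ K tie) (IRWState.enter Node.root))

/-! ### Polynomial decay to noise -/

/-- `μ_l = 1/2 - (1/2 - μ₀) (l + 1)^{-α}`, as a point of `[0, 1]` (the projection is the identity here
for `0 ≤ μ₀ ≤ 1/2`). -/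
def polyNoise (α : ℕ) (μ₀ : ℝ) (l : ℕ) : unitInterval :=
  Set.projIcc 0 1 zero_le_one (1 / 2 - (1 / 2 - μ₀) * (((l : ℝ) + 1) ^ α)⁻¹)

end TreeSearch

end

open TreeSearch

/-!
The walk is certified by a potential: a function of its current state that dominates the expected
loss still to come. Away from the leaves it is `β` times the distance to the target plus a
constant, so `β` is the price of a step away from the target. A local test of confidence level
`p > 1 / 2` moves the walk closer with probability at least `p`, and the expected decrease
`(2 * p - 1) * β` pays for its `2 * K_l` samples. At a leaf the sum log-likelihood ratio `S` is a
random walk; the cost of sampling is paid by its drift `± D(g₀‖f₀)`, and the consequences of leaving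
or of a wrong declaration are priced by a Wald martingale, `exp (-S)` at the target and `exp S`
elsewhere. Since the risk is at most the potential of the root, it remains to choose `β` of the
order of `c * n ^ (2 * α)`. This is possible because the error probability of the local test decays
exponentially in its sample size, with base the Bhattacharyya coefficient of the two laws, so that
`K_l = O(l ^ (2 * α))` samples suffice.
-/

noncomputable section

namespace TreeSearch

/-! ### Bernoulli laws and their log-likelihood ratios -/

section Bernoulli

variable {μ : ℕ → unitInterval} {l : ℕ}

instance isProbabilityMeasure_absentLaw : IsProbabilityMeasure (absentLaw μ l) := by
  unfold absentLaw; infer_instance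

instance isProbabilityMeasure_presentLaw : IsProbabilityMeasure (presentLaw μ l) := by
  unfold presentLaw; infer_instance

instance isProbabilityMeasure_obsLaw {n : ℕ} (m : Leaf n) (v : Node n) :
    IsProbabilityMeasure (obsLaw μ m v) := by
  unfold obsLaw; split_ifs <;> infer_instance

lemma integral_absentLaw (F : Bool → ℝ) :
    ∫ y, F y ∂absentLaw μ l = μ l * F true + (1 - μ l) * F false := by
  simp [absentLaw, integral_bernoulliMeasure]

lemma integral_presentLaw (F : Bool → ℝ) :
    ∫ y, F y ∂presentLaw μ l = (1 - μ l) * F true + μ l * F false := by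
  simp [presentLaw, integral_bernoulliMeasure]

variable (μ l) in
/-- The log-odds `log ((1 - μ_l) / μ_l)`: on level `l` an observation changes the sum log-likelihood
ratio by `± logOdds μ l`. -/
def logOdds : ℝ := Real.log ((1 - μ l) / μ l)

lemma logLR_true : logLR μ l true = logOdds μ l := by
  simp [logLR, logOdds, presentLaw, absentLaw]

lemma logLR_false : logLR μ l false = -logOdds μ l := by
  simp [logLR, logOdds, presentLaw, absentLaw, ← Real.log_inv]

variable (μ l) in
/-- The noise on level `l` is nondegenerate and better than a fair coin. -/
def Informative : Prop := 0 < (μ l : ℝ) ∧ (μ l : ℝ) < 1 / 2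

lemma Informative.one_sub_pos (h : Informative μ l) : 0 < 1 - (μ l : ℝ) := by linarith [h.2]

lemma Informative.gap_pos (h : Informative μ l) : 0 < 1 - 2 * (μ l : ℝ) := by linarith [h.2]

lemma Informative.logOdds_pos (h : Informative μ l) : 0 < logOdds μ l :=
  Real.log_pos ((one_lt_div h.1).2 (by linarith [h.2]))

lemma Informative.logLR_le (h : Informative μ l) (y : Bool) : logLR μ l y ≤ logOdds μ l := by
  have := h.logOdds_pos
  rcases y with _ | _
  · rw [logLR_false]
    linarith
  · exact logLR_true.le

lemma Informative.neg_logOdds_le_logLR (h : Informative μ l) (y : Bool) :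
    -logOdds μ l ≤ logLR μ l y := by
  have := h.logOdds_pos
  rcases y with _ | _
  · exact logLR_false.ge
  · rw [logLR_true]
    linarith

lemma Informative.mul_exp_logOdds (h : Informative μ l) :
    (μ l : ℝ) * Real.exp (logOdds μ l) = 1 - μ l := by
  rw [logOdds, Real.exp_log (div_pos h.one_sub_pos h.1), mul_div_cancel₀ _ h.1.ne']

lemma Informative.mul_exp_neg_logOdds (h : Informative μ l) :
    (1 - μ l : ℝ) * Real.exp (-logOdds μ l) = μ l := by
  rw [← h.mul_exp_logOdds, mul_assoc, ← Real.exp_add, add_neg_cancel, Real.exp_zero, mul_one]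

lemma Informative.presentLaw_eq_withDensity (h : Informative μ l) :
    presentLaw μ l =
      (absentLaw μ l).withDensity fun y => ENNReal.ofReal (Real.exp (logLR μ l y)) := by
  refine Measure.ext_of_singleton fun y => ?_
  have hp := ofReal_measureReal (μ := presentLaw μ l) (s := {y})
  have ha := ofReal_measureReal (μ := absentLaw μ l) (s := {y})
  rw [withDensity_apply _ (MeasurableSet.singleton y), lintegral_singleton, ← hp, ← ha,
    ← ENNReal.ofReal_mul (Real.exp_nonneg _), mul_comm]
  cases y
  · simp [presentLaw, absentLaw, logLR_false, h.mul_exp_neg_logOdds]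
  · simp [presentLaw, absentLaw, logLR_true, h.mul_exp_logOdds]

lemma toReal_klDiv_eq_integral_of_eq_withDensity {Ω : Type*} [MeasurableSpace Ω]
    {ρ ν : Measure Ω} [IsProbabilityMeasure ρ] [IsProbabilityMeasure ν] {f : Ω → ℝ}
    (hf : Measurable f) (hρ : ρ = ν.withDensity fun y => ENNReal.ofReal (Real.exp (f y))) :
    (InformationTheory.klDiv ρ ν).toReal = ∫ y, f y ∂ρ := by
  have hac : ρ ≪ ν := hρ ▸ withDensity_absolutelyContinuous _ _
  have hrn : ρ.rnDeriv ν =ᵐ[ν] fun y => ENNReal.ofReal (Real.exp (f y)) :=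
    hρ ▸ Measure.rnDeriv_withDensity ν hf.exp.ennreal_ofReal
  have hllr : llr ρ ν =ᵐ[ρ] f := by
    filter_upwards [hac.ae_le hrn] with y hy
    rw [llr, hy, ENNReal.toReal_ofReal (Real.exp_nonneg _), Real.log_exp]
  rw [InformationTheory.toReal_klDiv_of_measure_eq hac (by rw [measure_univ, measure_univ]),
    integral_congr_ae hllr]

variable (μ l) in
/-- The mean log-likelihood ratio of an observation whose node contains the target, which is the
Kullback–Leibler divergence `D(g_l ‖ f_l)`. -/
def divergence : ℝ := (1 - 2 * μ l) * logOdds μ l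

lemma Informative.toReal_klDiv (h : Informative μ l) :
    (InformationTheory.klDiv (presentLaw μ l) (absentLaw μ l)).toReal = divergence μ l := by
  rw [toReal_klDiv_eq_integral_of_eq_withDensity .of_discrete h.presentLaw_eq_withDensity,
    integral_presentLaw, logLR_true, logLR_false, divergence]
  ring

lemma Informative.divergence_pos (h : Informative μ l) : 0 < divergence μ l :=
  mul_pos h.gap_pos h.logOdds_pos

end Bernoulli

/-! ### Confidence levels of the local test -/

lemma measureReal_pi_sum_nonneg_le {Ω : Type*} [MeasurableSpace Ω] {ν : Measure Ω}
    [IsProbabilityMeasure ν] {f : Ω → ℝ} (hf : Measurable f) {t : ℝ} (ht : 0 ≤ t)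
    (hint : Integrable (fun y => Real.exp (t * f y)) ν) (k : ℕ) :
    (Measure.pi fun _ : Fin k => ν).real {z | 0 ≤ ∑ i, f (z i)} ≤ mgf f ν t ^ k := by
  have hmeas (i : Fin k) : Measurable fun z : Fin k → Ω => f (z i) :=
    hf.comp (measurable_pi_apply i)
  have hindep : iIndepFun (fun (i : Fin k) (z : Fin k → Ω) => f (z i)) (Measure.pi fun _ => ν) :=
    iIndepFun_pi fun _ => hf.aemeasurable
  have hmgf (i : Fin k) :
      mgf (fun z : Fin k → Ω => f (z i)) (Measure.pi fun _ => ν) t = mgf f ν t :=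
    integral_comp_eval (μ := fun _ : Fin k => ν) (i := i) hint.aestronglyMeasurable
  have hint' (i : Fin k) :
      Integrable (fun z : Fin k → Ω => Real.exp (t * f (z i))) (Measure.pi fun _ => ν) :=
    integrable_comp_eval (μ := fun _ : Fin k => ν) (i := i) hint
  have hchernoff := measure_ge_le_exp_mul_mgf 0 ht
    (hindep.integrable_exp_mul_sum hmeas fun i (_ : i ∈ Finset.univ) => hint' i)
  simpa [hindep.mgf_sum hmeas, hmgf] using hchernoff

section Overlap

variable {μ : ℕ → unitInterval} {l : ℕ}

variable (μ l) in
/-- The Bhattacharyya coefficient `2 √(μ_l (1 - μ_l))` of the two observation laws on level `l`. -/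
def overlap : ℝ := 2 * (μ l * Real.exp (logOdds μ l / 2))

lemma overlap_nonneg : 0 ≤ overlap μ l :=
  mul_nonneg zero_le_two (mul_nonneg (unitInterval.nonneg _) (Real.exp_nonneg _))

lemma Informative.one_sub_mul_exp_half (h : Informative μ l) :
    (1 - μ l : ℝ) * Real.exp (-(logOdds μ l / 2)) = μ l * Real.exp (logOdds μ l / 2) := by
  rw [← h.mul_exp_logOdds, mul_assoc, ← Real.exp_add]
  ring_nf

lemma Informative.mgf_absentLaw (h : Informative μ l) :
    mgf (logLR μ l) (absentLaw μ l) (1 / 2) = overlap μ l := by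
  have := h.one_sub_mul_exp_half
  rw [mgf, integral_absentLaw, logLR_true, logLR_false, overlap]
  ring_nf at this ⊢
  linarith

lemma Informative.mgf_presentLaw (h : Informative μ l) :
    mgf (-logLR μ l) (presentLaw μ l) (1 / 2) = overlap μ l := by
  have := h.one_sub_mul_exp_half
  rw [mgf, integral_presentLaw, Pi.neg_apply, Pi.neg_apply, logLR_true, logLR_false, overlap]
  ring_nf at this ⊢
  linarith

lemma Informative.overlap_sq (h : Informative μ l) :
    overlap μ l ^ 2 = 1 - (1 - 2 * μ l) ^ 2 := by
  rw [overlap, mul_pow, mul_pow, ← Real.exp_nat_mul, Nat.cast_two, mul_div_cancel₀ _ two_ne_zero,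
    pow_two (μ l : ℝ), mul_assoc, h.mul_exp_logOdds]
  ring

lemma Informative.overlap_le_exp (h : Informative μ l) :
    overlap μ l ≤ Real.exp (-((1 - 2 * μ l) ^ 2 / 2)) := by
  refine (pow_le_pow_iff_left₀ overlap_nonneg (Real.exp_nonneg _) two_ne_zero).1 ?_
  calc overlap μ l ^ 2 = -(1 - 2 * (μ l : ℝ)) ^ 2 + 1 := by rw [h.overlap_sq]; ring
    _ ≤ Real.exp (-(1 - 2 * (μ l : ℝ)) ^ 2) := Real.add_one_le_exp _
    _ = Real.exp (-((1 - 2 * μ l) ^ 2 / 2)) ^ 2 := by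
      rw [← Real.exp_nat_mul, Nat.cast_two]; ring_nf

lemma Informative.one_sub_overlap_pow_le_absentLaw (h : Informative μ l) (k : ℕ) :
    1 - overlap μ l ^ k ≤ (Measure.pi fun _ : Fin k => absentLaw μ l).real
      {z | ∑ i, logLR μ l (z i) < 0} := by
  have hle := measureReal_pi_sum_nonneg_le (ν := absentLaw μ l) .of_discrete
    one_half_pos.le (f := logLR μ l) .of_finite k
  have hcompl := probReal_compl_eq_one_sub (μ := Measure.pi fun _ : Fin k => absentLaw μ l)
    (.of_discrete (s := {z | 0 ≤ ∑ i, logLR μ l (z i)}))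
  simp only [Set.compl_ofPred, not_le] at hcompl
  rw [h.mgf_absentLaw] at hle
  linarith

lemma Informative.one_sub_overlap_pow_le_presentLaw (h : Informative μ l) (k : ℕ) :
    1 - overlap μ l ^ k ≤ (Measure.pi fun _ : Fin k => presentLaw μ l).real
      {z | 0 < ∑ i, logLR μ l (z i)} := by
  have hle := measureReal_pi_sum_nonneg_le (ν := presentLaw μ l) .of_discrete
    one_half_pos.le (f := -logLR μ l) .of_finite k
  have hcompl := probReal_compl_eq_one_sub (μ := Measure.pi fun _ : Fin k => presentLaw μ l)
    (.of_discrete (s := {z | 0 ≤ ∑ i, (-logLR μ l) (z i)}))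
  simp only [Set.compl_ofPred, not_le, Pi.neg_apply, Finset.sum_neg_distrib, neg_lt_zero]
    at hcompl
  simp only [h.mgf_presentLaw, Pi.neg_apply, Finset.sum_neg_distrib] at hle hcompl
  linarith

lemma Informative.meetsConfidence (h : Informative μ (l - 1)) {η : ℝ} (hη : 0 < η) {k : ℕ}
    (hk : overlap μ (l - 1) ^ k < 1 - η) : MeetsConfidence μ (η ^ 2) l k := by
  have habsent : η < (Measure.pi fun _ : Fin k => absentLaw μ (l - 1)).real
      {z | ∑ i, logLR μ (l - 1) (z i) < 0} := by
    linarith [h.one_sub_overlap_pow_le_absentLaw k]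
  have hpresent : η < (Measure.pi fun _ : Fin k => presentLaw μ (l - 1)).real
      {z | 0 < ∑ i, logLR μ (l - 1) (z i)} := by
    linarith [h.one_sub_overlap_pow_le_presentLaw k]
  refine ⟨?_, pow_lt_pow_left₀ habsent hη.le two_ne_zero⟩
  calc η ^ 2 = η * η := sq η
    _ < _ := mul_lt_mul'' hpresent habsent hη.le hη.le
    _ = _ := (measureReal_prod_prod _ _).symm
    _ ≤ confPresent μ l k :=
      measureReal_mono fun _ hw => Set.mem_ofPred.2 (max_lt (hw.2.trans hw.1) hw.1)

lemma log_one_div_one_sub_pos {η : ℝ} (hη : 0 < η) (hη' : η < 1) :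
    0 < Real.log (1 / (1 - η)) :=
  Real.log_pos ((one_lt_div (sub_pos.2 hη')).2 (sub_lt_self 1 hη))

lemma Informative.meetsConfidence_explicitSampleSize (h : Informative μ (l - 1)) {η : ℝ}
    (hη : 0 < η) (hη' : η < 1) : MeetsConfidence μ (η ^ 2) l (explicitSampleSize μ η l) := by
  refine h.meetsConfidence hη ?_
  set k := explicitSampleSize μ η l
  set q : ℝ := (μ (l - 1) : ℝ)
  have hlog := log_one_div_one_sub_pos hη hη'
  have hceil : 12 * (1 - q) * Real.log (1 / (1 - η)) ≤ k * (1 - 2 * q) ^ 2 :=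
    (div_le_iff₀ (pow_pos h.gap_pos 2)).1 (Nat.le_ceil _)
  calc overlap μ (l - 1) ^ k ≤ Real.exp (-((1 - 2 * q) ^ 2 / 2)) ^ k :=
        pow_le_pow_left₀ overlap_nonneg h.overlap_le_exp k
    _ = Real.exp (k * -((1 - 2 * q) ^ 2 / 2)) := (Real.exp_nat_mul _ _).symm
    _ < Real.exp (-Real.log (1 / (1 - η))) := Real.exp_lt_exp.2 (by nlinarith [h.2])
    _ = 1 - η := by rw [one_div, Real.log_inv, neg_neg, Real.exp_log (by linarith)]

lemma Informative.meetsConfidence_explicitSampleSize_sqrt (h : Informative μ (l - 1)) {p : ℝ}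
    (hp : 0 < p) (hp' : p < 1) : MeetsConfidence μ p l (explicitSampleSize μ (Real.sqrt p) l) := by
  have := h.meetsConfidence_explicitSampleSize (Real.sqrt_pos.2 hp)
    ((Real.sqrt_lt' one_pos).2 (by rwa [one_pow]))
  rwa [Real.sq_sqrt hp.le] at this

lemma Informative.meetsConfidence_minSampleSize (h : Informative μ (l - 1)) {p : ℝ} (hp : 0 < p)
    (hp' : p < 1) : MeetsConfidence μ p l (minSampleSize μ p l) :=
  Nat.sInf_mem (s := {k | MeetsConfidence μ p l k})
    ⟨_, h.meetsConfidence_explicitSampleSize_sqrt hp hp'⟩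

lemma Informative.minSampleSize_le (h : Informative μ (l - 1)) {p : ℝ} (hp : 0 < p)
    (hp' : p < 1) : minSampleSize μ p l ≤ explicitSampleSize μ (Real.sqrt p) l :=
  Nat.sInf_le (h.meetsConfidence_explicitSampleSize_sqrt hp hp')

end Overlap

/-! ### Verification of a risk bound by a potential function -/

instance finite_node (n : ℕ) : Finite (Node n) := List.finite_length_le Bool n

instance isProbabilityMeasure_hypMeasure {n : ℕ} (μ : ℕ → unitInterval) (m : Leaf n) :
    IsProbabilityMeasure (hypMeasure μ m) := by
  unfold hypMeasure; infer_instance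

lemma lintegral_prodMk_of_indepFun {Ω E F : Type*} [MeasurableSpace Ω] [MeasurableSpace E]
    [MeasurableSpace F] {P : Measure Ω} [IsProbabilityMeasure P] {X : Ω → E} {Y : Ω → F}
    (hX : Measurable X) (hY : Measurable Y) (h : IndepFun X Y P) {φ : E × F → ℝ≥0∞}
    (hφ : Measurable φ) :
    ∫⁻ ω, φ (X ω, Y ω) ∂P = ∫⁻ ω, ∫⁻ y, φ (X ω, y) ∂P.map Y ∂P := by
  have := Measure.isProbabilityMeasure_map (μ := P) hY.aemeasurable
  rw [← lintegral_map hφ (hX.prodMk hY),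
    (indepFun_iff_map_prod_eq_prod_map_map hX.aemeasurable hY.aemeasurable).1 h,
    lintegral_prod _ hφ.aemeasurable, lintegral_map hφ.lintegral_prod_right' hX]

namespace Strategy

variable {n : ℕ} (Γ : Strategy n) (μ : ℕ → unitInterval) (m : Leaf n)

lemma history_congr {ω ω' : ℕ → Node n → Bool} {t : ℕ} (h : ∀ s < t, ω s = ω' s) :
    Γ.history ω t = Γ.history ω' t := by
  induction t with
  | zero => rfl
  | succ t ih =>
    simp only [history, ih fun s hs => h s (hs.trans (Nat.lt_succ_self t)),
      h t (Nat.lt_succ_self t)]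

lemma exists_history_eq_comp_restrict (t : ℕ) :
    ∃ e : (Finset.range t → Node n → Bool) → List Bool,
      ∀ ω, Γ.history ω t = e ((Finset.range t).restrict ω) := by
  have h : (fun ω => Γ.history ω t).FactorsThrough (Finset.range t).restrict :=
    fun ω ω' hω => Γ.history_congr fun s hs => congrFun hω ⟨s, Finset.mem_range.2 hs⟩
  obtain ⟨e, he⟩ := (Function.factorsThrough_iff _).1 h
  exact ⟨e, fun ω => congrFun he ω⟩

lemma measurable_comp_history (t : ℕ) (F : List Bool → ℝ≥0∞) :
    Measurable fun ω => F (Γ.history ω t) := by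
  obtain ⟨e, he⟩ := Γ.exists_history_eq_comp_restrict t
  simp only [he]
  exact (Measurable.of_discrete (f := fun x => F (e x))).comp (Finset.measurable_restrict _)

lemma indepFun_restrict_eval (t : ℕ) :
    IndepFun (Finset.range t).restrict (fun ω => ω t) (hypMeasure μ m) := by
  have hindep : iIndepFun (fun (s : ℕ) (ω : ℕ → Node n → Bool) => ω s) (hypMeasure μ m) :=
    iIndepFun_infinitePi (X := fun _ ω => ω) fun _ => measurable_id
  have heval : Measurable fun x : ({t} : Finset ℕ) → Node n → Bool =>
      x ⟨t, Finset.mem_singleton_self t⟩ := by fun_prop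
  exact (hindep.indepFun_finset (Finset.range t) {t} (by simp) fun s => by fun_prop).comp
    measurable_id heval

lemma lintegral_history_obs (t : ℕ) (φ : List Bool → (Node n → Bool) → ℝ≥0∞) :
    ∫⁻ ω, φ (Γ.history ω t) (ω t) ∂hypMeasure μ m =
      ∫⁻ ω, ∫⁻ w, φ (Γ.history ω t) w ∂(Measure.infinitePi fun v => obsLaw μ m v)
        ∂hypMeasure μ m := by
  obtain ⟨e, he⟩ := Γ.exists_history_eq_comp_restrict t
  have hmap : (hypMeasure μ m).map (fun ω => ω t) = Measure.infinitePi fun v => obsLaw μ m v :=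
    Measure.infinitePi_map_eval _ t
  simp only [he, ← hmap]
  exact lintegral_prodMk_of_indepFun (φ := fun x => φ (e x.1) x.2)
    (Finset.measurable_restrict _) (measurable_pi_apply t) (indepFun_restrict_eval μ m t)
    .of_discrete

/-- The indicator of the histories after which the strategy takes a further observation. -/
def running (h : List Bool) : ℝ≥0∞ := if (Γ h).isLeft then 1 else 0

/-- A potential function: it dominates the expected loss still to come after a given history when
leaf `m` is the target and a probe costs `c`. -/
structure IsPotential (c : ℝ≥0∞) (Φ : List Bool → ℝ≥0∞) : Prop where
  step : ∀ h v, Γ h = Sum.inl v → c + ∫⁻ y, Φ (h ++ [y]) ∂obsLaw μ m v ≤ Φ h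
  wrong : ∀ h m', Γ h = Sum.inr m' → m' ≠ m → 1 ≤ Φ h

variable {Γ μ m} {c : ℝ≥0∞} {Φ : List Bool → ℝ≥0∞}

lemma IsPotential.lintegral_succ (hΦ : Γ.IsPotential μ m c Φ) (t : ℕ) :
    c * ∫⁻ ω, Γ.running (Γ.history ω t) ∂hypMeasure μ m +
        ∫⁻ ω, Φ (Γ.history ω (t + 1)) ∂hypMeasure μ m ≤
      ∫⁻ ω, Φ (Γ.history ω t) ∂hypMeasure μ m := by
  let φ : List Bool → (Node n → Bool) → ℝ≥0∞ := fun h w =>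
    c * Γ.running h + Φ (match Γ h with | Sum.inl v => h ++ [w v] | Sum.inr _ => h)
  have hφ (h : List Bool) : ∫⁻ w, φ h w ∂(Measure.infinitePi fun v => obsLaw μ m v) ≤ Φ h := by
    rcases hv : Γ h with v | m'
    · have heval := (measurePreserving_eval_infinitePi (obsLaw μ m) v).lintegral_comp
        (f := fun y => c + Φ (h ++ [y])) .of_discrete
      calc _ = ∫⁻ y, c + Φ (h ++ [y]) ∂obsLaw μ m v := by
            simpa [φ, running, hv] using heval
        _ = c + ∫⁻ y, Φ (h ++ [y]) ∂obsLaw μ m v := by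
            rw [lintegral_add_left measurable_const, lintegral_const, measure_univ, mul_one]
        _ ≤ Φ h := hΦ.step h v hv
    · simp [φ, running, hv]
  calc _ = ∫⁻ ω, φ (Γ.history ω t) (ω t) ∂hypMeasure μ m := by
        rw [← lintegral_const_mul _ (Γ.measurable_comp_history t _),
          ← lintegral_add_left ((Γ.measurable_comp_history t _).const_mul c)]
        refine lintegral_congr fun ω => ?_
        cases h : Γ (Γ.history ω t) <;> simp only [φ, history, h]
    _ ≤ _ := by
        rw [Γ.lintegral_history_obs μ m t φ]
        exact lintegral_mono fun ω => hφ _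

lemma IsPotential.sum_running_le (hΦ : Γ.IsPotential μ m c Φ) (t : ℕ) :
    c * ∑ s ∈ Finset.range t, ∫⁻ ω, Γ.running (Γ.history ω s) ∂hypMeasure μ m +
        ∫⁻ ω, Φ (Γ.history ω t) ∂hypMeasure μ m ≤ Φ [] := by
  induction t with
  | zero => simp [history]
  | succ t ih =>
    refine le_trans ?_ ih
    rw [Finset.sum_range_succ, mul_add, add_assoc]
    gcongr
    exact hΦ.lintegral_succ t

lemma IsPotential.measure_not_declares_le (hΦ : Γ.IsPotential μ m c Φ) (t : ℕ) :
    hypMeasure μ m {ω | ¬ Γ.Declares m ω} ≤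
      ∫⁻ ω, Γ.running (Γ.history ω t) ∂hypMeasure μ m +
        ∫⁻ ω, Φ (Γ.history ω t) ∂hypMeasure μ m := by
  have hmeas := Γ.measurable_comp_history t fun h => Γ.running h + Φ h
  rw [← lintegral_add_left (Γ.measurable_comp_history t _)]
  calc _ ≤ hypMeasure μ m {ω | 1 ≤ Γ.running (Γ.history ω t) + Φ (Γ.history ω t)} := by
        refine measure_mono fun ω (hω : ¬ Γ.Declares m ω) => ?_
        rw [Set.mem_ofPred_eq]
        rcases hv : Γ (Γ.history ω t) with v | m'
        · simp [running, hv]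
        · refine le_add_left (hΦ.wrong _ m' hv ?_)
          rintro rfl
          exact hω ⟨t, hv⟩
    _ ≤ _ := by simpa using mul_meas_ge_le_lintegral hmeas 1

variable (Γ) in
lemma stopTime_le_tsum_running (ω : ℕ → Node n → Bool) :
    Γ.stopTime ω ≤ ∑' t, Γ.running (Γ.history ω t) := by
  classical
  by_cases h : ∃ t, (Γ (Γ.history ω t)).isRight
  · have hrun : ∀ t ∈ Finset.range (Nat.find h), Γ.running (Γ.history ω t) = 1 := fun t ht => by
      have := Nat.find_min h (Finset.mem_range.1 ht)
      rw [Sum.not_isRight] at this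
      simp [running, this]
    calc Γ.stopTime ω ≤ (Nat.find h : ℝ≥0∞) := iInf₂_le (Nat.find h) (Nat.find_spec h)
      _ = ∑ t ∈ Finset.range (Nat.find h), Γ.running (Γ.history ω t) := by
        simp [Finset.sum_congr rfl hrun]
      _ ≤ _ := ENNReal.sum_le_tsum _
  · simp only [not_exists, Sum.not_isRight] at h
    simp [running, h, ENNReal.tsum_const_eq_top_of_ne_zero one_ne_zero]

lemma lintegral_stopTime_le :
    ∫⁻ ω, Γ.stopTime ω ∂hypMeasure μ m ≤
      ∑' t, ∫⁻ ω, Γ.running (Γ.history ω t) ∂hypMeasure μ m := by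
  rw [← lintegral_tsum fun t => (Γ.measurable_comp_history t _).aemeasurable]
  exact lintegral_mono Γ.stopTime_le_tsum_running

theorem IsPotential.risk_le (hΦ : Γ.IsPotential μ m c Φ) (hc : c ≠ 0) (hc' : c ≠ ⊤) :
    hypMeasure μ m {ω | ¬ Γ.Declares m ω} + c * ∫⁻ ω, Γ.stopTime ω ∂hypMeasure μ m ≤ Φ [] := by
  rcases eq_or_ne (Φ []) ⊤ with htop | htop
  · exact htop ▸ le_top
  set N : ℕ → ℝ≥0∞ := fun t => ∫⁻ ω, Γ.running (Γ.history ω t) ∂hypMeasure μ m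
  have hsum : Filter.Tendsto (fun t => c * ∑ s ∈ Finset.range t, N s) Filter.atTop
      (nhds (c * ∑' s, N s)) :=
    ENNReal.Tendsto.const_mul ENNReal.summable.hasSum.tendsto_sum_nat (Or.inr hc')
  have hfin : ∑' s, N s ≠ ⊤ := fun h => by
    have hle : c * ∑' s, N s ≤ Φ [] :=
      le_of_tendsto' hsum fun t => le_self_add.trans (hΦ.sum_running_le t)
    rw [h, ENNReal.mul_top hc] at hle
    exact htop (top_le_iff.1 hle)
  have hfinite (t : ℕ) : hypMeasure μ m {ω | ¬ Γ.Declares m ω} +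
      c * ∑ s ∈ Finset.range t, N s ≤ N t + Φ [] :=
    calc _ ≤ N t + ∫⁻ ω, Φ (Γ.history ω t) ∂hypMeasure μ m + c * ∑ s ∈ Finset.range t, N s := by
          gcongr; exact hΦ.measure_not_declares_le t
      _ = N t + (c * ∑ s ∈ Finset.range t, N s + ∫⁻ ω, Φ (Γ.history ω t) ∂hypMeasure μ m) := by
          ring
      _ ≤ N t + Φ [] := by gcongr; exact hΦ.sum_running_le t
  calc _ ≤ hypMeasure μ m {ω | ¬ Γ.Declares m ω} + c * ∑' s, N s := by
        gcongr; exact lintegral_stopTime_le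
    _ ≤ 0 + Φ [] := le_of_tendsto_of_tendsto' (tendsto_const_nhds.add hsum)
        ((ENNReal.tendsto_atTop_zero_of_tsum_ne_top hfin).add tendsto_const_nhds) hfinite
    _ = Φ [] := zero_add _

/-- The strategy that folds the observations into a state by `update`, starting from `s₀`, and
chooses its action from the current state. -/
def ofAutomaton {S : Type*} (act : S → Node n ⊕ Leaf n) (update : S → Bool → S) (s₀ : S) :
    Strategy n :=
  fun obs => act (obs.foldl update s₀)

lemma isPotential_ofAutomaton {S : Type*} {act : S → Node n ⊕ Leaf n} {update : S → Bool → S}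
    {s₀ : S} {I : S → Prop} {Ψ : S → ℝ≥0∞} (h₀ : I s₀) (hI : ∀ s y, I s → I (update s y))
    (hstep : ∀ s v, I s → act s = Sum.inl v → c + ∫⁻ y, Ψ (update s y) ∂obsLaw μ m v ≤ Ψ s)
    (hwrong : ∀ s m', I s → act s = Sum.inr m' → m' ≠ m → 1 ≤ Ψ s) :
    (ofAutomaton act update s₀).IsPotential μ m c fun obs => Ψ (obs.foldl update s₀) := by
  have hfold (obs : List Bool) : I (obs.foldl update s₀) := by
    induction obs using List.reverseRecOn with
    | nil => exact h₀
    | append_singleton obs y ih => rw [List.foldl_concat]; exact hI _ y ih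
  refine ⟨fun obs v hv => ?_, fun obs m' => hwrong _ m' (hfold obs)⟩
  simpa only [List.foldl_concat] using hstep _ v (hfold obs) hv

end Strategy

/-! ### Distances in the tree -/

namespace Node

variable {n : ℕ}

/-- The number of edges between the leaf `m` and the node with the given turns, in the tree of depth
`n`: a node that does not contain `m` is one step further away than its parent. -/
def turnsDist (n : ℕ) (m : List Bool) : List Bool → ℕ
  | [] => n
  | b :: v => if b :: v <:+ m then n - (v.length + 1) else turnsDist n m v + 1

/-- The distance in the tree from a node to a leaf. -/
def dist (v : Node n) (m : Leaf n) : ℕ := turnsDist n m.toList v.1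

lemma dist_root (m : Leaf n) : (root : Node n).dist m = n := rfl

lemma Contains.dist_eq {v : Node n} {m : Leaf n} (h : v.Contains m) :
    v.dist m = n - v.1.length := by
  obtain ⟨_ | ⟨b, v⟩, hv⟩ := v
  · rfl
  · exact if_pos h

lemma parent_dist_of_not_contains {v : Node n} {m : Leaf n} (h : ¬ v.Contains m) :
    v.parent.dist m + 1 = v.dist m := by
  obtain ⟨_ | ⟨b, v⟩, hv⟩ := v
  · exact absurd List.nil_suffix h
  · exact (if_neg h).symm

lemma Contains.parent {v : Node n} {m : Leaf n} (h : v.Contains m) : v.parent.Contains m :=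
  (List.tail_suffix _).trans h

lemma parent_dist_le (v : Node n) (m : Leaf n) : v.parent.dist m ≤ v.dist m + 1 := by
  by_cases h : v.Contains m
  · rw [h.dist_eq, h.parent.dist_eq, parent, List.length_tail]
    omega
  · have := parent_dist_of_not_contains h
    omega

lemma dist_pos {v : Node n} (hv : v.1.length < n) (m : Leaf n) : 1 ≤ v.dist m := by
  by_cases h : v.Contains m
  · rw [h.dist_eq]
    omega
  · have := parent_dist_of_not_contains h
    omega

lemma child_val {v : Node n} (hv : v.1.length < n) (b : Bool) : (v.child b).1 = b :: v.1 := by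
  simp [child, hv]

lemma child_level {v : Node n} (hv : v.1.length < n) (b : Bool) :
    (v.child b).level = v.level - 1 := by
  simp only [level, child_val hv, List.length_cons]
  omega

lemma parent_child {v : Node n} (hv : v.1.length < n) (b : Bool) : (v.child b).parent = v := by
  simp [child, hv, parent]

lemma contains_of_child_contains {v : Node n} (hv : v.1.length < n) {b : Bool} {m : Leaf n}
    (h : (v.child b).Contains m) : v.Contains m :=
  parent_child hv b ▸ h.parent

lemma child_dist_of_contains {v : Node n} (hv : v.1.length < n) {b : Bool} {m : Leaf n}
    (h : (v.child b).Contains m) : (v.child b).dist m + 1 = v.dist m := by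
  rw [h.dist_eq, (contains_of_child_contains hv h).dist_eq, child_val hv, List.length_cons]
  omega

lemma child_dist_le (v : Node n) (b : Bool) (m : Leaf n) : (v.child b).dist m ≤ v.dist m + 1 := by
  by_cases hv : v.1.length < n
  · by_cases h : (v.child b).Contains m
    · have := child_dist_of_contains hv h
      omega
    · exact (parent_child hv b ▸ parent_dist_of_not_contains h).ge
  · simp [child, hv]

lemma Contains.exists_child {v : Node n} {m : Leaf n} (h : v.Contains m) (hv : v.1.length < n) :
    ∃ b, (v.child b).Contains m ∧ ¬ (v.child (!b)).Contains m := by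
  obtain ⟨u, hu⟩ := h
  rcases List.eq_nil_or_concat u with rfl | ⟨u, b, rfl⟩
  · rw [List.nil_append] at hu
    exact absurd (hu ▸ m.2 : v.1.length = n) hv.ne
  · have hb : (b :: v.1) <:+ m.toList := ⟨u, by simpa using hu⟩
    refine ⟨b, by rwa [Contains, child_val hv], fun hb' => ?_⟩
    rw [Contains, child_val hv] at hb'
    have := (List.suffix_of_suffix_length_le hb hb' (by simp)).eq_of_length (by simp)
    simp at this

end Node

/-! ### Drift of the walk on the upper levels -/

lemma lintegral_le_of_drift {Ω : Type*} [MeasurableSpace Ω] {P : Measure Ω}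
    [IsProbabilityMeasure P] {X : Ω → ℝ≥0∞} {E : Set Ω} {a p β t : ℝ} (hβ : 0 ≤ β) (hβa : β ≤ a)
    (ht : 0 ≤ t) (hE : MeasurableSet E) (hp : p ≤ P.real E)
    (hup : ∀ z, X z ≤ ENNReal.ofReal (a + β)) (hdown : ∀ z ∈ E, X z ≤ ENNReal.ofReal (a - β))
    (htp : t + β ≤ 2 * β * p) :
    ENNReal.ofReal t + ∫⁻ z, X z ∂P ≤ ENNReal.ofReal a := by
  have hpoint (z : Ω) : X z + E.indicator (fun _ => ENNReal.ofReal (2 * β)) z ≤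
      ENNReal.ofReal (a + β) := by
    by_cases hz : z ∈ E
    · calc _ ≤ ENNReal.ofReal (a - β) + ENNReal.ofReal (2 * β) := by
            rw [Set.indicator_of_mem hz]
            gcongr
            exact hdown z hz
        _ = ENNReal.ofReal (a + β) := by
            rw [← ENNReal.ofReal_add (by linarith) (by linarith)]
            ring_nf
    · rw [Set.indicator_of_notMem hz, add_zero]
      exact hup z
  refine (ENNReal.add_le_add_iff_right (a := ENNReal.ofReal β) ENNReal.ofReal_ne_top).1 ?_
  calc _ = ∫⁻ z, X z ∂P + ENNReal.ofReal (t + β) := by rw [ENNReal.ofReal_add ht hβ]; ring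
    _ ≤ ∫⁻ z, X z ∂P + ENNReal.ofReal (2 * β) * P E := by
        rw [← ofReal_measureReal, ← ENNReal.ofReal_mul (by positivity)]
        gcongr
        exact htp.trans (by gcongr)
    _ = ∫⁻ z, X z + E.indicator (fun _ => ENNReal.ofReal (2 * β)) z ∂P := by
        rw [lintegral_add_right _ (measurable_const.indicator hE), lintegral_indicator_const hE]
    _ ≤ ∫⁻ _, ENNReal.ofReal (a + β) ∂P := lintegral_mono hpoint
    _ = ENNReal.ofReal a + ENNReal.ofReal β := by
        rw [lintegral_const, measure_univ, mul_one, ENNReal.ofReal_add (hβ.trans hβa) hβ]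

section LocalTest

variable {n : ℕ} {μ : ℕ → unitInterval} {m : Leaf n} {v : Node n} {p sL sR : ℝ}

lemma obsLaw_of_contains (h : v.Contains m) : obsLaw μ m v = presentLaw μ v.level := if_pos h

lemma obsLaw_of_not_contains (h : ¬ v.Contains m) : obsLaw μ m v = absentLaw μ v.level := if_neg h

lemma localTestMove_of_neg (tie : Node n → Bool) (hL : sL < 0) (hR : sR < 0) :
    localTestMove tie v sL sR = v.parent := if_pos ⟨hL, hR⟩

lemma localTestMove_of_max_lt_left (tie : Node n → Bool) (h : max sR 0 < sL) :
    localTestMove tie v sL sR = v.child true := by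
  obtain ⟨hlt, hpos⟩ := max_lt_iff.1 h
  rw [localTestMove, if_neg fun h => hpos.not_gt h.1, if_pos hlt]

lemma localTestMove_of_max_lt_right (tie : Node n → Bool) (h : max sL 0 < sR) :
    localTestMove tie v sL sR = v.child false := by
  obtain ⟨hlt, hpos⟩ := max_lt_iff.1 h
  rw [localTestMove, if_neg fun h => hpos.not_gt h.2, if_neg hlt.not_gt, if_pos hlt]

lemma localTestMove_dist_le (tie : Node n → Bool) (v : Node n) (sL sR : ℝ) (m : Leaf n) :
    (localTestMove tie v sL sR).dist m ≤ v.dist m + 1 := by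
  unfold localTestMove
  split_ifs
  exacts [v.parent_dist_le m, v.child_dist_le _ m, v.child_dist_le _ m, v.child_dist_le _ m]

variable (μ m v) in
/-- The joint law of the `2 k` observations of a local test at `v`, those of the left child first,
when leaf `m` is the target. -/
def testLaw (k : ℕ) : Measure ((Fin k → Bool) × (Fin k → Bool)) :=
  (Measure.pi fun _ => obsLaw μ m (v.child true)).prod
    (Measure.pi fun _ => obsLaw μ m (v.child false))

instance isProbabilityMeasure_testLaw (k : ℕ) : IsProbabilityMeasure (testLaw μ m v k) := by
  unfold testLaw; infer_instance

variable (μ v) in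
/-- The move after a local test at `v` with observations `z`. -/
def testMove (tie : Node n → Bool) (k : ℕ) (z : (Fin k → Bool) × (Fin k → Bool)) : Node n :=
  localTestMove tie v (∑ i, logLR μ (v.level - 1) (z.1 i)) (∑ i, logLR μ (v.level - 1) (z.2 i))

lemma confPresent_le_of_left_contains (tie : Node n → Bool) (hv : v.1.length < n)
    (hL : (v.child true).Contains m) (hR : ¬ (v.child false).Contains m) (k : ℕ) :
    confPresent μ v.level k ≤
      (testLaw μ m v k).real {z | (testMove μ v tie k z).dist m + 1 = v.dist m} := by
  rw [testLaw, obsLaw_of_contains hL, obsLaw_of_not_contains hR, Node.child_level hv,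
    Node.child_level hv]
  refine measureReal_mono fun z hz => ?_
  rw [Set.mem_ofPred_eq, testMove, localTestMove_of_max_lt_left tie hz,
    Node.child_dist_of_contains hv hL]

lemma confPresent_le_of_right_contains (tie : Node n → Bool) (hv : v.1.length < n)
    (hR : (v.child false).Contains m) (hL : ¬ (v.child true).Contains m) (k : ℕ) :
    confPresent μ v.level k ≤
      (testLaw μ m v k).real {z | (testMove μ v tie k z).dist m + 1 = v.dist m} := by
  rw [confPresent, measureReal_def, ← Measure.prod_swap,
    Measure.map_apply measurable_swap .of_discrete, ← measureReal_def, testLaw,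
    obsLaw_of_contains hR, obsLaw_of_not_contains hL, Node.child_level hv, Node.child_level hv]
  refine measureReal_mono fun z hz => ?_
  rw [Set.mem_preimage, Set.mem_ofPred_eq, Prod.fst_swap, Prod.snd_swap] at hz
  rw [Set.mem_ofPred_eq, testMove, localTestMove_of_max_lt_right tie hz,
    Node.child_dist_of_contains hv hR]

lemma confAbsent_le_of_not_contains (tie : Node n → Bool) (hv : v.1.length < n)
    (h : ¬ v.Contains m) (k : ℕ) :
    confAbsent μ v.level k ≤
      (testLaw μ m v k).real {z | (testMove μ v tie k z).dist m + 1 = v.dist m} := by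
  have hchild (b : Bool) : ¬ (v.child b).Contains m :=
    fun hb => h (Node.contains_of_child_contains hv hb)
  rw [confAbsent, sq, ← measureReal_prod_prod, testLaw, obsLaw_of_not_contains (hchild _),
    obsLaw_of_not_contains (hchild _), Node.child_level hv, Node.child_level hv]
  refine measureReal_mono fun z hz => ?_
  rw [Set.mem_ofPred_eq, testMove, localTestMove_of_neg tie hz.1 hz.2,
    Node.parent_dist_of_not_contains h]

lemma MeetsConfidence.le_measureReal_closer {k : ℕ} (hk : MeetsConfidence μ p v.level k)
    (tie : Node n → Bool) (hv : v.1.length < n) (m : Leaf n) :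
    p ≤ (testLaw μ m v k).real {z | (testMove μ v tie k z).dist m + 1 = v.dist m} := by
  by_cases h : v.Contains m
  · obtain ⟨_ | _, hb, hb'⟩ := h.exists_child hv
    · exact hk.1.le.trans (confPresent_le_of_right_contains tie hv hb hb' k)
    · exact hk.1.le.trans (confPresent_le_of_left_contains tie hv hb hb' k)
  · exact hk.2.le.trans (confAbsent_le_of_not_contains tie hv h k)

lemma MeetsConfidence.lintegral_testMove_le {k : ℕ} (hk : MeetsConfidence μ p v.level k)
    (tie : Node n → Bool) (hv : v.1.length < n) (m : Leaf n) {β γ t : ℝ} (hβ : 0 ≤ β)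
    (hγ : 0 ≤ γ) (ht : 0 ≤ t) (htp : t + β ≤ 2 * β * p) :
    ENNReal.ofReal t +
        ∫⁻ z, ENNReal.ofReal (β * (testMove μ v tie k z).dist m + γ) ∂testLaw μ m v k ≤
      ENNReal.ofReal (β * v.dist m + γ) := by
  have hdist : (1 : ℝ) ≤ v.dist m := by exact_mod_cast Node.dist_pos hv m
  refine lintegral_le_of_drift hβ (by nlinarith) ht .of_discrete
    (hk.le_measureReal_closer tie hv m) (fun z => ?_) (fun z hz => ?_) htp
  · have hmove : ((testMove μ v tie k z).dist m : ℝ) ≤ v.dist m + 1 := by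
      exact_mod_cast localTestMove_dist_le tie v _ _ m
    exact ENNReal.ofReal_le_ofReal (by nlinarith)
  · have hmove : ((testMove μ v tie k z).dist m : ℝ) + 1 = v.dist m := by exact_mod_cast hz
    exact ENNReal.ofReal_le_ofReal (by rw [← hmove]; linarith)

end LocalTest

/-! ### The potential of the walk -/

section Potential

variable {n : ℕ}

/-- Expectation of `F (x + f y₁ + ⋯ + f yₖ)` for independent `y₁, …, yₖ` with law `ν`. -/
def sumExp (ν : Measure Bool) (f : Bool → ℝ) (k : ℕ) (F : ℝ → ℝ≥0∞) (x : ℝ) : ℝ≥0∞ :=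
  ∫⁻ z : Fin k → Bool, F (x + ∑ i, f (z i)) ∂Measure.pi fun _ => ν

section SumExp

variable {ν : Measure Bool} [IsProbabilityMeasure ν] {f : Bool → ℝ} {F : ℝ → ℝ≥0∞}

lemma sumExp_zero (x : ℝ) : sumExp ν f 0 F x = F x := by
  simp [sumExp]

lemma sumExp_succ (k : ℕ) (x : ℝ) :
    sumExp ν f (k + 1) F x = ∫⁻ y, sumExp ν f k F (x + f y) ∂ν := by
  have hsplit := (measurePreserving_piFinSuccAbove (fun _ : Fin (k + 1) => ν) 0).symm
  rw [sumExp, ← hsplit.lintegral_comp .of_discrete,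
    lintegral_prod _ Measurable.of_discrete.aemeasurable]
  simp [sumExp, Fin.sum_univ_succ, MeasurableEquiv.piFinSuccAbove, add_assoc]

lemma lintegral_testMove (μ : ℕ → unitInterval) (m : Leaf n) (v : Node n) (tie : Node n → Bool)
    (k : ℕ) (G : Node n → ℝ≥0∞) :
    ∫⁻ z, G (testMove μ v tie k z) ∂testLaw μ m v k =
      sumExp (obsLaw μ m (v.child true)) (logLR μ (v.level - 1)) k (fun x =>
        sumExp (obsLaw μ m (v.child false)) (logLR μ (v.level - 1)) k (fun y =>
          G (localTestMove tie v x y)) 0) 0 := by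
  rw [testLaw, lintegral_prod _ Measurable.of_discrete.aemeasurable]
  simp only [sumExp, zero_add, testMove]

end SumExp

/-- Potential of the target leaf when the sum log-likelihood ratio of the current visit is `x` and
a step away from the target has price `β`. The sum drifts upwards by `divergence μ 0` per sample,
and `exp (-x)` is a martingale; its coefficient is such that the walk can pay for leaving. -/
def targetPotential (μ : ℕ → unitInterval) (n : ℕ) (c β x : ℝ) : ℝ :=
  c / divergence μ 0 * (Real.log (n / c) + logOdds μ 0 - x) +
    β / (Real.exp (logOdds μ 0) - 1) * Real.exp (-x)

/-- Excess potential of a leaf other than the target over its parent when the sum log-likelihood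
ratio of the current visit is `x`. The martingale `exp x` is scaled to be `1` at the stopping
threshold. -/
def otherPotential (μ : ℕ → unitInterval) (n : ℕ) (c x : ℝ) : ℝ :=
  c / divergence μ 0 * (x + logOdds μ 0) + Real.exp (x - Real.log (n / c))

namespace Informative

variable {μ : ℕ → unitInterval} {c β x : ℝ}

lemma targetPotential_nonneg (h : Informative μ 0) (hc : 0 ≤ c) (hβ : 0 ≤ β)
    (hx : x ≤ Real.log (n / c) + logOdds μ 0) : 0 ≤ targetPotential μ n c β x := by
  have hexp : 0 < Real.exp (logOdds μ 0) - 1 := sub_pos.2 (Real.one_lt_exp_iff.2 h.logOdds_pos)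
  have := h.divergence_pos
  have := sub_nonneg.2 hx
  unfold targetPotential
  positivity

lemma exp_le_otherPotential (h : Informative μ 0) (hc : 0 ≤ c) (hx : -logOdds μ 0 ≤ x) :
    Real.exp (x - Real.log (n / c)) ≤ otherPotential μ n c x := by
  have := h.divergence_pos
  have : 0 ≤ x + logOdds μ 0 := by linarith
  exact le_add_of_nonneg_left (by positivity)

lemma otherPotential_nonneg (h : Informative μ 0) (hc : 0 ≤ c) (hx : -logOdds μ 0 ≤ x) :
    0 ≤ otherPotential μ n c x :=
  (Real.exp_pos _).le.trans (h.exp_le_otherPotential hc hx)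

lemma targetPotential_step (h : Informative μ 0) (n : ℕ) (c β x : ℝ) :
    c + ∫ y, targetPotential μ n c β (x + logLR μ 0 y) ∂presentLaw μ 0 =
      targetPotential μ n c β x := by
  have hdrift : c / divergence μ 0 * ((1 - 2 * μ 0) * logOdds μ 0) = c :=
    div_mul_cancel₀ c h.divergence_pos.ne'
  simp only [integral_presentLaw, logLR_true, logLR_false, targetPotential, neg_add, neg_neg,
    Real.exp_add]
  linear_combination -hdrift + β / (Real.exp (logOdds μ 0) - 1) * Real.exp (-x) *
    (h.mul_exp_logOdds + h.mul_exp_neg_logOdds)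

lemma otherPotential_step (h : Informative μ 0) (n : ℕ) (c x : ℝ) :
    c + ∫ y, otherPotential μ n c (x + logLR μ 0 y) ∂absentLaw μ 0 = otherPotential μ n c x := by
  have hdrift : c / divergence μ 0 * ((1 - 2 * μ 0) * logOdds μ 0) = c :=
    div_mul_cancel₀ c h.divergence_pos.ne'
  simp only [integral_absentLaw, logLR_true, logLR_false, otherPotential, add_sub_right_comm x,
    Real.exp_add]
  linear_combination -hdrift + Real.exp (x - Real.log (n / c)) *
    (h.mul_exp_logOdds + h.mul_exp_neg_logOdds)

lemma add_targetPotential_zero_le (h : Informative μ 0) (hc : 0 ≤ c) (n : ℕ) (β : ℝ) :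
    β + targetPotential μ n c β 0 ≤ targetPotential μ n c β (-logOdds μ 0) := by
  have hexp : Real.exp (logOdds μ 0) - 1 ≠ 0 :=
    (sub_pos.2 (Real.one_lt_exp_iff.2 h.logOdds_pos)).ne'
  have hD := h.divergence_pos
  have hL := h.logOdds_pos
  have hcost : 0 ≤ c / divergence μ 0 * logOdds μ 0 := by positivity
  have hprice : β / (Real.exp (logOdds μ 0) - 1) * (Real.exp (logOdds μ 0) - 1) = β :=
    div_mul_cancel₀ β hexp
  rw [targetPotential, targetPotential, neg_neg, neg_zero, Real.exp_zero]
  linarith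

end Informative

/-- Potential at the beginning of a visit to `v`. -/
def entryPotential (μ : ℕ → unitInterval) (c β : ℝ) (m : Leaf n) (v : Node n) : ℝ≥0∞ :=
  ENNReal.ofReal (β * v.dist m + targetPotential μ n c β 0)

open scoped Classical in
/-- Potential during a visit to the leaf `v`, with sum log-likelihood ratio `x`. -/
def leafPotential (μ : ℕ → unitInterval) (c β : ℝ) (m : Leaf n) (v : Node n) (x : ℝ) : ℝ≥0∞ :=
  if v.Contains m then ENNReal.ofReal (targetPotential μ n c β x)
  else entryPotential μ c β m v.parent + ENNReal.ofReal (otherPotential μ n c x)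

/-- Potential during a local test: the cost of the remaining samples and the expected potential
after the move. Of the samples that remain, `K - count` (truncated) belong to the left child and
`2 * K - max K count` to the right child. -/
def testPotential (μ : ℕ → unitInterval) (K : ℕ → ℕ) (tie : Node n → Bool) (c β : ℝ) (m : Leaf n)
    (s : IRWState n) : ℝ≥0∞ :=
  ENNReal.ofReal c * (2 * K s.node.level - s.count : ℕ) +
    sumExp (obsLaw μ m (s.node.child true)) (logLR μ (s.node.level - 1))
      (K s.node.level - s.count) (fun x =>
        sumExp (obsLaw μ m (s.node.child false)) (logLR μ (s.node.level - 1))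
          (2 * K s.node.level - max (K s.node.level) s.count) (fun y =>
            entryPotential μ c β m (localTestMove tie s.node x y)) s.sumR) s.sumL

/-- Potential of a state of the walk: a bound for the expected loss to come. -/
def statePotential (μ : ℕ → unitInterval) (K : ℕ → ℕ) (tie : Node n → Bool) (c β : ℝ) (m : Leaf n)
    (s : IRWState n) : ℝ≥0∞ :=
  if s.node.1.length = n then leafPotential μ c β m s.node s.sumL
  else testPotential μ K tie c β m s

/-- An invariant of the walk: the sum at a leaf is a natural multiple of `logOdds μ 0`, and a local
test takes at most `2 * K l` samples. -/
structure IRWState.Reachable (μ : ℕ → unitInterval) (K : ℕ → ℕ) (s : IRWState n) : Prop where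
  leaf : s.node.1.length = n → ∃ j : ℕ, s.sumL = j * logOdds μ 0
  test : s.node.1.length ≠ n → s.count < 2 * K s.node.level

variable {μ : ℕ → unitInterval} {K : ℕ → ℕ} {tie : Node n → Bool} {c β p x y : ℝ} {m : Leaf n}
  {v : Node n} {k : ℕ} {s : IRWState n}

lemma Node.level_eq_zero (hv : v.1.length = n) : v.level = 0 := by
  rw [level, hv, Nat.sub_self]

lemma Node.length_lt (hv : v.1.length ≠ n) : v.1.length < n := v.2.lt_of_ne hv

lemma Node.one_le_level (hv : v.1.length ≠ n) : 1 ≤ v.level := Nat.sub_pos_of_lt (length_lt hv)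

lemma Node.level_le (v : Node n) : v.level ≤ n := Nat.sub_le _ _

lemma reachable_enter (hK : ∀ l, 1 ≤ l → l ≤ n → 0 < K l) (v : Node n) :
    (IRWState.enter v).Reachable μ K where
  leaf _ := ⟨0, by simp [IRWState.enter]⟩
  test hv := Nat.mul_pos two_pos (hK v.level (Node.one_le_level hv) v.level_le)

lemma natCast_mul_logOdds_add_logLR (j : ℕ) (y : Bool) :
    (∃ i : ℕ, j * logOdds μ 0 + logLR μ 0 y = i * logOdds μ 0) ∨
      j * logOdds μ 0 + logLR μ 0 y = -logOdds μ 0 := by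
  rcases y with _ | _
  · rw [logLR_false]
    rcases j with _ | j
    · exact Or.inr (by simp)
    · exact Or.inl ⟨j, by push_cast; ring⟩
  · exact Or.inl ⟨j + 1, by rw [logLR_true]; push_cast; ring⟩

lemma IRWState.Reachable.update (hK : ∀ l, 1 ≤ l → l ≤ n → 0 < K l) (h : Informative μ 0)
    (hs : s.Reachable μ K) (y : Bool) : (irwUpdate μ K tie s y).Reachable μ K := by
  unfold irwUpdate
  split_ifs with hleaf hneg hleft hright
  · exact reachable_enter hK _
  · refine ⟨fun _ => ?_, fun hv => absurd hleaf hv⟩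
    obtain ⟨j, hj⟩ := hs.leaf hleaf
    rw [hj] at hneg ⊢
    exact (natCast_mul_logOdds_add_logLR j y).resolve_right fun hexit =>
      hneg (hexit ▸ neg_neg_of_pos h.logOdds_pos)
  · exact ⟨fun hv => absurd hv hleaf, fun _ => by dsimp only; omega⟩
  · exact ⟨fun hv => absurd hv hleaf, fun _ => hright⟩
  · exact reachable_enter hK _

lemma leafPotential_step_of_contains (h : Informative μ 0) (hc : 0 ≤ c) (hβ : 0 ≤ β)
    (hv : v.1.length = n) (hm : v.Contains m) (hx : x ≤ Real.log (n / c)) :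
    ENNReal.ofReal c + ∫⁻ y, leafPotential μ c β m v (x + logLR μ 0 y) ∂obsLaw μ m v =
      leafPotential μ c β m v x := by
  have hnonneg (y : Bool) : 0 ≤ targetPotential μ n c β (x + logLR μ 0 y) :=
    h.targetPotential_nonneg hc hβ (add_le_add hx (h.logLR_le y))
  simp only [leafPotential, if_pos hm]
  rw [obsLaw_of_contains hm, Node.level_eq_zero hv,
    ← ofReal_integral_eq_lintegral_ofReal .of_finite (.of_forall hnonneg),
    ← ENNReal.ofReal_add hc (integral_nonneg hnonneg), h.targetPotential_step]

lemma leafPotential_step_of_not_contains (h : Informative μ 0) (hc : 0 ≤ c)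
    (hv : v.1.length = n) (hm : ¬ v.Contains m) (hx : 0 ≤ x) :
    ENNReal.ofReal c + ∫⁻ y, leafPotential μ c β m v (x + logLR μ 0 y) ∂obsLaw μ m v =
      leafPotential μ c β m v x := by
  have hnonneg (y : Bool) : 0 ≤ otherPotential μ n c (x + logLR μ 0 y) :=
    h.otherPotential_nonneg hc (by linarith [h.neg_logOdds_le_logLR y])
  simp only [leafPotential, if_neg hm]
  rw [lintegral_add_left measurable_const, lintegral_const, measure_univ, mul_one,
    obsLaw_of_not_contains hm, Node.level_eq_zero hv,
    ← ofReal_integral_eq_lintegral_ofReal .of_finite (.of_forall hnonneg),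
    add_left_comm, ← ENNReal.ofReal_add hc (integral_nonneg hnonneg), h.otherPotential_step]

lemma leafPotential_step (h : Informative μ 0) (hc : 0 ≤ c) (hβ : 0 ≤ β) (hv : v.1.length = n)
    (hx : 0 ≤ x) (hx' : x ≤ Real.log (n / c)) :
    ENNReal.ofReal c + ∫⁻ y, leafPotential μ c β m v (x + logLR μ 0 y) ∂obsLaw μ m v =
      leafPotential μ c β m v x := by
  by_cases hm : v.Contains m
  · exact leafPotential_step_of_contains h hc hβ hv hm hx'
  · exact leafPotential_step_of_not_contains h hc hv hm hx

/-- `β` is an admissible price of a step away from the target: it pays for a visit to a wrong leaf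
and, through the drift towards the target, for the local tests. -/
structure IsPrice (μ : ℕ → unitInterval) (n : ℕ) (K : ℕ → ℕ) (p c β : ℝ) : Prop where
  informative : Informative μ 0
  cost_pos : 0 < c
  cost_le : c ≤ n
  conf : 0 ≤ p
  meets : ∀ l, 1 ≤ l → l ≤ n → MeetsConfidence μ p l (K l)
  other : otherPotential μ n c 0 ≤ β
  test : ∀ l, 1 ≤ l → l ≤ n → c * (2 * K l) + β ≤ 2 * β * p

lemma MeetsConfidence.sampleSize_pos {l : ℕ} (hp : 0 ≤ p) (hk : MeetsConfidence μ p l k) :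
    0 < k := by
  refine Nat.pos_of_ne_zero fun hzero => hk.1.not_ge ?_
  subst hzero
  simpa [confPresent] using hp

namespace IsPrice

lemma sampleSize_pos (hβ : IsPrice μ n K p c β) (l : ℕ) (hl : 1 ≤ l) (hl' : l ≤ n) : 0 < K l :=
  (hβ.meets l hl hl').sampleSize_pos hβ.conf

lemma threshold_nonneg (hβ : IsPrice μ n K p c β) : 0 ≤ Real.log (n / c) :=
  Real.log_nonneg ((one_le_div hβ.cost_pos).2 hβ.cost_le)

lemma nonneg (hβ : IsPrice μ n K p c β) : 0 ≤ β :=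
  (hβ.informative.otherPotential_nonneg hβ.cost_pos.le
    (neg_nonpos.2 hβ.informative.logOdds_pos.le)).trans hβ.other

lemma targetPotential_zero_nonneg (hβ : IsPrice μ n K p c β) : 0 ≤ targetPotential μ n c β 0 :=
  hβ.informative.targetPotential_nonneg hβ.cost_pos.le hβ.nonneg
    (add_nonneg hβ.threshold_nonneg hβ.informative.logOdds_pos.le)

lemma leafPotential_zero_le (hβ : IsPrice μ n K p c β) (m : Leaf n) (v : Node n) :
    leafPotential μ c β m v 0 ≤ entryPotential μ c β m v := by
  have hβ₀ := hβ.nonneg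
  have htarget := hβ.targetPotential_zero_nonneg
  unfold leafPotential entryPotential
  split_ifs with hm
  · exact ENNReal.ofReal_le_ofReal (le_add_of_nonneg_left (by positivity))
  · have hother := hβ.informative.otherPotential_nonneg (n := n) hβ.cost_pos.le
      (neg_nonpos.2 hβ.informative.logOdds_pos.le)
    rw [← ENNReal.ofReal_add (by positivity) hother, ← Node.parent_dist_of_not_contains hm]
    refine ENNReal.ofReal_le_ofReal ?_
    push_cast
    linarith [hβ.other]

lemma testPotential_enter_le (hβ : IsPrice μ n K p c β) (tie : Node n → Bool) (m : Leaf n)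
    (hv : v.1.length ≠ n) :
    testPotential μ K tie c β m (IRWState.enter v) ≤ entryPotential μ c β m v := by
  have hl := Node.one_le_level hv
  have hc := hβ.cost_pos.le
  have hcost : ENNReal.ofReal c * (2 * K v.level : ℕ) = ENNReal.ofReal (c * (2 * K v.level)) := by
    rw [ENNReal.ofReal_mul hc, ← ENNReal.ofReal_natCast]
    push_cast
    rfl
  have hright : 2 * K v.level - max (K v.level) 0 = K v.level := by omega
  simp only [testPotential, IRWState.enter, Nat.sub_zero]
  rw [hright, hcost, ← lintegral_testMove μ m v tie _ (entryPotential μ c β m)]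
  exact (hβ.meets _ hl v.level_le).lintegral_testMove_le tie (Node.length_lt hv) m hβ.nonneg
    hβ.targetPotential_zero_nonneg (by positivity) (hβ.test _ hl v.level_le)

lemma statePotential_enter_le (hβ : IsPrice μ n K p c β) (tie : Node n → Bool) (m : Leaf n)
    (v : Node n) :
    statePotential μ K tie c β m (IRWState.enter v) ≤ entryPotential μ c β m v := by
  unfold statePotential
  split_ifs with hv
  · exact hβ.leafPotential_zero_le m v
  · exact hβ.testPotential_enter_le tie m hv

lemma entryPotential_parent_le (hβ : IsPrice μ n K p c β) (m : Leaf n) (hv : v.1.length = n) :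
    entryPotential μ c β m v.parent ≤ leafPotential μ c β m v (-logOdds μ 0) := by
  unfold leafPotential
  split_ifs with hm
  · have hdist : v.parent.dist m ≤ 1 := by
      have := v.parent_dist_le m
      rwa [hm.dist_eq, hv, Nat.sub_self] at this
    have hdist' : (v.parent.dist m : ℝ) ≤ 1 := by exact_mod_cast hdist
    refine ENNReal.ofReal_le_ofReal (le_trans ?_
      (hβ.informative.add_targetPotential_zero_le hβ.cost_pos.le n β))
    gcongr
    exact mul_le_of_le_one_right hβ.nonneg hdist'
  · exact le_self_add

lemma statePotential_update_leaf_le (hβ : IsPrice μ n K p c β) (tie : Node n → Bool) (m : Leaf n)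
    (hs : s.Reachable μ K) (hv : s.node.1.length = n) (y : Bool) :
    statePotential μ K tie c β m (irwUpdate μ K tie s y) ≤
      leafPotential μ c β m s.node (s.sumL + logLR μ 0 y) := by
  unfold irwUpdate
  rw [if_pos hv]
  split_ifs with hneg
  · have hexit : s.sumL + logLR μ 0 y = -logOdds μ 0 := by
      obtain ⟨j, hj⟩ := hs.leaf hv
      rw [hj] at hneg ⊢
      refine (natCast_mul_logOdds_add_logLR j y).resolve_left fun ⟨i, hi⟩ => hneg.not_ge ?_
      exact hi ▸ mul_nonneg i.cast_nonneg hβ.informative.logOdds_pos.le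
    rw [hexit]
    exact (hβ.statePotential_enter_le tie m _).trans (hβ.entryPotential_parent_le m hv)
  · rw [statePotential, if_pos hv]

lemma statePotential_step_leaf (hβ : IsPrice μ n K p c β) (tie : Node n → Bool) (m : Leaf n)
    (hs : s.Reachable μ K) (hv : s.node.1.length = n) (hx : s.sumL ≤ Real.log (n / c)) :
    ENNReal.ofReal c + ∫⁻ y, statePotential μ K tie c β m (irwUpdate μ K tie s y)
      ∂obsLaw μ m s.node ≤ statePotential μ K tie c β m s := by
  have hx₀ : 0 ≤ s.sumL := by
    obtain ⟨j, hj⟩ := hs.leaf hv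
    exact hj ▸ mul_nonneg j.cast_nonneg hβ.informative.logOdds_pos.le
  calc _ ≤ ENNReal.ofReal c +
        ∫⁻ y, leafPotential μ c β m s.node (s.sumL + logLR μ 0 y) ∂obsLaw μ m s.node := by
        gcongr
        exact hβ.statePotential_update_leaf_le tie m hs hv _
    _ = leafPotential μ c β m s.node s.sumL :=
        leafPotential_step hβ.informative hβ.cost_pos.le hβ.nonneg hv hx₀ hx
    _ = statePotential μ K tie c β m s := (if_pos hv).symm

lemma testPotential_step_left (hv : s.node.1.length ≠ n) (hk : s.count < K s.node.level) :
    ENNReal.ofReal c + ∫⁻ y, statePotential μ K tie c β m (irwUpdate μ K tie s y)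
      ∂obsLaw μ m (s.node.child true) = testPotential μ K tie c β m s := by
  have hcount : 2 * K s.node.level - s.count = 2 * K s.node.level - (s.count + 1) + 1 := by omega
  have hleft : K s.node.level - s.count = K s.node.level - (s.count + 1) + 1 := by omega
  simp only [irwUpdate, if_neg hv, if_pos hk, statePotential, testPotential, max_eq_left hk.le,
    max_eq_left (Nat.succ_le_of_lt hk), hcount, hleft, sumExp_succ, Nat.cast_succ]
  rw [lintegral_add_left measurable_const, lintegral_const, measure_univ]
  ring

lemma testPotential_step_right (hv : s.node.1.length ≠ n) (hk : K s.node.level ≤ s.count)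
    (hk' : s.count + 1 < 2 * K s.node.level) :
    ENNReal.ofReal c + ∫⁻ y, statePotential μ K tie c β m (irwUpdate μ K tie s y)
      ∂obsLaw μ m (s.node.child false) = testPotential μ K tie c β m s := by
  have hcount : 2 * K s.node.level - s.count = 2 * K s.node.level - (s.count + 1) + 1 := by omega
  simp only [irwUpdate, if_neg hv, if_neg hk.not_gt, if_pos hk', statePotential, testPotential,
    max_eq_right hk, max_eq_right (hk.trans (Nat.le_succ _)), Nat.sub_eq_zero_of_le hk,
    Nat.sub_eq_zero_of_le (hk.trans (Nat.le_succ _)), sumExp_zero, hcount, sumExp_succ,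
    Nat.cast_succ]
  rw [lintegral_add_left measurable_const, lintegral_const, measure_univ]
  ring

lemma testPotential_step_last (hβ : IsPrice μ n K p c β) (tie : Node n → Bool) (m : Leaf n)
    (hv : s.node.1.length ≠ n) (hk : K s.node.level ≤ s.count)
    (hk' : s.count + 1 = 2 * K s.node.level) :
    ENNReal.ofReal c + ∫⁻ y, statePotential μ K tie c β m (irwUpdate μ K tie s y)
      ∂obsLaw μ m (s.node.child false) ≤ testPotential μ K tie c β m s := by
  have hcount : 2 * K s.node.level - s.count = 0 + 1 := by omega
  simp only [irwUpdate, if_neg hv, if_neg hk.not_gt, if_neg hk'.not_lt, testPotential,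
    max_eq_right hk, Nat.sub_eq_zero_of_le hk, sumExp_zero, hcount, sumExp_succ]
  rw [zero_add, Nat.cast_one, mul_one]
  gcongr
  exact hβ.statePotential_enter_le tie m _

lemma statePotential_step_test (hβ : IsPrice μ n K p c β) (tie : Node n → Bool) (m : Leaf n)
    (hs : s.Reachable μ K) (hv : s.node.1.length ≠ n) :
    ENNReal.ofReal c + ∫⁻ y, statePotential μ K tie c β m (irwUpdate μ K tie s y)
      ∂obsLaw μ m (s.node.child (decide (s.count < K s.node.level))) ≤
        statePotential μ K tie c β m s := by
  rw [statePotential.eq_def μ K tie c β m s, if_neg hv]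
  rcases lt_or_ge s.count (K s.node.level) with hk | hk
  · rw [decide_eq_true hk]
    exact (testPotential_step_left hv hk).le
  · rw [decide_eq_false hk.not_gt]
    rcases (Nat.succ_le_of_lt (hs.test hv)).lt_or_eq with hk' | hk'
    · exact (testPotential_step_right hv hk hk').le
    · exact hβ.testPotential_step_last tie m hv hk hk'

lemma statePotential_step (hβ : IsPrice μ n K p c β) (tie : Node n → Bool) (m : Leaf n)
    (hs : s.Reachable μ K) (hact : irwAct K c s = Sum.inl v) :
    ENNReal.ofReal c + ∫⁻ y, statePotential μ K tie c β m (irwUpdate μ K tie s y)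
      ∂obsLaw μ m v ≤ statePotential μ K tie c β m s := by
  unfold irwAct at hact
  split_ifs at hact with hv hx hk <;> obtain rfl := Sum.inl.inj hact
  · exact hβ.statePotential_step_leaf tie m hs hv (not_lt.1 hx)
  · simpa only [decide_eq_true hk] using hβ.statePotential_step_test tie m hs hv
  · simpa only [decide_eq_false hk] using hβ.statePotential_step_test tie m hs hv

lemma one_le_statePotential (hβ : IsPrice μ n K p c β) {m' : Leaf n}
    (hact : irwAct K c s = Sum.inr m') (hm : m' ≠ m) : 1 ≤ statePotential μ K tie c β m s := by
  unfold irwAct at hact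
  split_ifs at hact with hv hx
  have hnot : ¬ s.node.Contains m := fun h => by
    refine hm (Sum.inr.inj hact ▸ Subtype.ext ?_)
    exact List.IsSuffix.eq_of_length h (hv.trans m.2.symm)
  have hexp : 1 ≤ Real.exp (s.sumL - Real.log (n / c)) := Real.one_le_exp (sub_nonneg.2 hx.le)
  rw [statePotential, if_pos hv, leafPotential, if_neg hnot]
  refine le_add_left (ENNReal.one_le_ofReal.2 (hexp.trans ?_))
  exact hβ.informative.exp_le_otherPotential hβ.cost_pos.le
    (by linarith [hβ.threshold_nonneg, hβ.informative.logOdds_pos])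

lemma isPotential (hβ : IsPrice μ n K p c β) (tie : Node n → Bool) (m : Leaf n) :
    (irw n μ K tie c).IsPotential μ m (ENNReal.ofReal c) fun obs =>
      statePotential μ K tie c β m
        (obs.foldl (irwUpdate μ K tie) (IRWState.enter Node.root)) :=
  Strategy.isPotential_ofAutomaton (I := IRWState.Reachable μ K)
    (reachable_enter hβ.sampleSize_pos _)
    (fun _ y hs => hs.update hβ.sampleSize_pos hβ.informative y)
    (fun _ _ hs => hβ.statePotential_step tie m hs)
    (fun _ _ _ => hβ.one_le_statePotential)

theorem bayesRisk_le (hβ : IsPrice μ n K p c β) (tie : Node n → Bool) (π : PMF (Leaf n)) :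
    (irw n μ K tie c).bayesRisk μ π c ≤
      ENNReal.ofReal (β * n + targetPotential μ n c β 0) := by
  have hroot (m : Leaf n) : entryPotential μ c β m Node.root =
      ENNReal.ofReal (β * n + targetPotential μ n c β 0) := by
    rw [entryPotential, Node.dist_root]
  have hrisk (m : Leaf n) : hypMeasure μ m {ω | ¬ (irw n μ K tie c).Declares m ω} +
      ENNReal.ofReal c * ∫⁻ ω, (irw n μ K tie c).stopTime ω ∂hypMeasure μ m ≤
        ENNReal.ofReal (β * n + targetPotential μ n c β 0) :=
    ((hβ.isPotential tie m).risk_le (ENNReal.ofReal_pos.2 hβ.cost_pos).ne'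
      ENNReal.ofReal_ne_top).trans ((hβ.statePotential_enter_le tie m _).trans_eq (hroot m))
  have hπ : ∑ m, π m = 1 := by rw [← tsum_fintype (L := .unconditional _), π.tsum_coe]
  rw [Strategy.bayesRisk, Strategy.errorProb, Strategy.sampleComplexity, Finset.mul_sum,
    ← Finset.sum_add_distrib]
  calc _ = ∑ m, π m * (hypMeasure μ m {ω | ¬ (irw n μ K tie c).Declares m ω} +
        ENNReal.ofReal c * ∫⁻ ω, (irw n μ K tie c).stopTime ω ∂hypMeasure μ m) :=
        Finset.sum_congr rfl fun m _ => by ring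
    _ ≤ ∑ m, π m * ENNReal.ofReal (β * n + targetPotential μ n c β 0) := by
        gcongr
        exact hrisk _
    _ = ENNReal.ofReal (β * n + targetPotential μ n c β 0) := by
        rw [← Finset.sum_mul, hπ, one_mul]

end IsPrice

end Potential

/-! ### Sample sizes of polynomial growth -/

section PolynomialGap

/-- The distance of `μ l` from pure noise decays at most polynomially, with exponent `α`: the gap
`1 - 2 * μ l` is at least `κ / (l + 1) ^ α`. -/
structure HasPolynomialGap (μ : ℕ → unitInterval) (α : ℕ) (κ : ℝ) : Prop where
  pos : ∀ l, 0 < (μ l : ℝ)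
  const_pos : 0 < κ
  const_le : ∀ l : ℕ, κ ≤ (1 - 2 * (μ l : ℝ)) * ((l : ℝ) + 1) ^ α

/-- Factor of `l ^ (2 * α)` in the bound on the closed-form sample size on level `l`. -/
def sizeFactor (κ η : ℝ) : ℝ := 12 * Real.log (1 / (1 - η)) / κ ^ 2 + 1

/-- Factor of `n ^ (2 * α)` in the bound on a sample rule. As the closed-form size with parameter
`√p` has confidence level `p`, it bounds the least one. -/
def ruleFactor (κ p η : ℝ) (A : ℕ) : ℝ := A * max (sizeFactor κ √p) (sizeFactor κ η)

variable {μ : ℕ → unitInterval} {α : ℕ} {κ p η : ℝ} {A n l : ℕ} {K : ℕ → ℕ}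

lemma HasPolynomialGap.informative (h : HasPolynomialGap μ α κ) (l : ℕ) : Informative μ l := by
  have hgap := pos_of_mul_pos_left (h.const_pos.trans_le (h.const_le l)) (by positivity)
  exact ⟨h.pos l, by linarith⟩

lemma sizeFactor_nonneg (hη : 0 < η) (hη' : η < 1) : 0 ≤ sizeFactor κ η := by
  have := log_one_div_one_sub_pos hη hη'
  unfold sizeFactor
  positivity

lemma ruleFactor_nonneg (hη : 0 < η) (hη' : η < 1) : 0 ≤ ruleFactor κ p η A :=
  mul_nonneg A.cast_nonneg (le_max_of_le_right (sizeFactor_nonneg hη hη'))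

lemma HasPolynomialGap.explicitSampleSize_le (h : HasPolynomialGap μ α κ) (hη : 0 < η)
    (hη' : η < 1) (hl : 1 ≤ l) :
    (explicitSampleSize μ η l : ℝ) ≤ sizeFactor κ η * (l : ℝ) ^ (2 * α) := by
  have hlog := log_one_div_one_sub_pos hη hη'
  have hinf := h.informative (l - 1)
  have hμ := hinf.one_sub_pos
  have hgap := hinf.gap_pos
  have hκ := h.const_pos
  have hκle := h.const_le (l - 1)
  rw [Nat.cast_pred hl, sub_add_cancel] at hκle
  have hsq : κ ^ 2 ≤ (1 - 2 * (μ (l - 1) : ℝ)) ^ 2 * (l : ℝ) ^ (2 * α) := by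
    rw [mul_comm 2 α, pow_mul, ← mul_pow]
    exact pow_le_pow_left₀ hκ.le hκle 2
  have hone : (1 : ℝ) ≤ (l : ℝ) ^ (2 * α) := one_le_pow₀ (by exact_mod_cast hl)
  refine (Nat.ceil_lt_add_one (by positivity)).le.trans ?_
  calc 12 * (1 - (μ (l - 1) : ℝ)) * Real.log (1 / (1 - η)) / (1 - 2 * (μ (l - 1) : ℝ)) ^ 2 + 1
      ≤ 12 * 1 * Real.log (1 / (1 - η)) / (1 - 2 * (μ (l - 1) : ℝ)) ^ 2 + 1 := by
        gcongr
        linarith [hinf.1]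
    _ ≤ 12 * Real.log (1 / (1 - η)) / κ ^ 2 * (l : ℝ) ^ (2 * α) + (l : ℝ) ^ (2 * α) := by
        gcongr ?_ + ?_
        rw [mul_one, div_mul_eq_mul_div, div_le_div_iff₀ (by positivity) (by positivity),
          mul_assoc _ _ ((1 - 2 * (μ (l - 1) : ℝ)) ^ 2), mul_comm ((l : ℝ) ^ (2 * α))]
        gcongr
    _ = sizeFactor κ η * (l : ℝ) ^ (2 * α) := by rw [sizeFactor, add_mul, one_mul]

lemma IsSampleRule.le_mul_pow (hK : IsSampleRule μ p η A n K) (h : HasPolynomialGap μ α κ)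
    (hp : 0 < p) (hp' : p < 1) (hη : 0 < η) (hη' : η < 1) (hl : 1 ≤ l) (hln : l ≤ n) :
    (K l : ℝ) ≤ ruleFactor κ p η A * (n : ℝ) ^ (2 * α) := by
  have hmin : (minSampleSize μ p l : ℝ) ≤ sizeFactor κ √p * (l : ℝ) ^ (2 * α) :=
    (Nat.cast_le.2 ((h.informative (l - 1)).minSampleSize_le hp hp')).trans
      (h.explicitSampleSize_le (Real.sqrt_pos.2 hp) ((Real.sqrt_lt' one_pos).2 (by linarith)) hl)
  have hex := h.explicitSampleSize_le hη hη' hl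
  calc (K l : ℝ) ≤ A * max (minSampleSize μ p l : ℝ) (explicitSampleSize μ η l) := by
        exact_mod_cast (hK l hl hln).2
    _ ≤ A * max (sizeFactor κ √p * (l : ℝ) ^ (2 * α)) (sizeFactor κ η * (l : ℝ) ^ (2 * α)) := by
        gcongr
    _ = ruleFactor κ p η A * (l : ℝ) ^ (2 * α) := by
        rw [← max_mul_of_nonneg _ _ (by positivity), ruleFactor, mul_assoc]
    _ ≤ ruleFactor κ p η A * (n : ℝ) ^ (2 * α) := by
        have := ruleFactor_nonneg (κ := κ) (p := p) (A := A) hη hη'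
        gcongr

end PolynomialGap

section PolyNoise

variable (α : ℕ) {μ₀ : ℝ}

lemma coe_polyNoise (hμ₀ : 0 ≤ μ₀) (hμ₀' : μ₀ ≤ 1 / 2) (l : ℕ) :
    (polyNoise α μ₀ l : ℝ) = 1 / 2 - (1 / 2 - μ₀) * (((l : ℝ) + 1) ^ α)⁻¹ := by
  have hpos : 0 < (((l : ℝ) + 1) ^ α)⁻¹ := by positivity
  have hle : (((l : ℝ) + 1) ^ α)⁻¹ ≤ 1 :=
    inv_le_one_of_one_le₀ (one_le_pow₀ (le_add_of_nonneg_left l.cast_nonneg))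
  rw [polyNoise, Set.projIcc_of_mem zero_le_one (by constructor <;> nlinarith)]

lemma hasPolynomialGap_polyNoise (hμ₀ : 0 < μ₀) (hμ₀' : μ₀ < 1 / 2) :
    HasPolynomialGap (polyNoise α μ₀) α (1 - 2 * μ₀) where
  pos l := by
    have hle : (((l : ℝ) + 1) ^ α)⁻¹ ≤ 1 :=
      inv_le_one_of_one_le₀ (one_le_pow₀ (le_add_of_nonneg_left l.cast_nonneg))
    rw [coe_polyNoise α hμ₀.le hμ₀'.le]
    nlinarith
  const_pos := by linarith
  const_le l := by
    have : ((l : ℝ) + 1) ^ α ≠ 0 := by positivity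
    rw [coe_polyNoise α hμ₀.le hμ₀'.le]
    field_simp
    linarith

end PolyNoise

/-! ### The risk of the walk -/

section Risk

variable {μ : ℕ → unitInterval} {α : ℕ} {κ p η b c : ℝ} {A n : ℕ} {K : ℕ → ℕ}

lemma Informative.otherPotential_zero (h : Informative μ 0) (hc : 0 < c) (hcn : c ≤ n) :
    otherPotential μ n c 0 = c * (1 - 2 * (μ 0 : ℝ))⁻¹ + c / n := by
  have := h.logOdds_pos.ne'
  have := h.gap_pos.ne'
  have hn : (0 : ℝ) < n := hc.trans_le hcn
  rw [otherPotential, divergence, zero_sub, ← Real.log_inv, inv_div,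
    Real.exp_log (by positivity), zero_add]
  field_simp

lemma Informative.isPrice (h : Informative μ 0) (hc : 0 < c) (hcn : c ≤ n) (hp : 0 ≤ p)
    (hK : ∀ l, 1 ≤ l → l ≤ n → MeetsConfidence μ p l (K l))
    (hb : (1 - 2 * (μ 0 : ℝ))⁻¹ + 1 ≤ b)
    (hKb : ∀ l, 1 ≤ l → l ≤ n → 2 * (K l : ℝ) ≤ b * (2 * p - 1)) :
    IsPrice μ n K p c (c * b) where
  informative := h
  cost_pos := hc
  cost_le := hcn
  conf := hp
  meets := hK
  other := by
    have hn : (1 : ℝ) ≤ n := by exact_mod_cast Nat.cast_pos.1 (hc.trans_le hcn)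
    calc otherPotential μ n c 0 = c * (1 - 2 * (μ 0 : ℝ))⁻¹ + c / n := h.otherPotential_zero hc hcn
      _ ≤ c * (1 - 2 * (μ 0 : ℝ))⁻¹ + c := by gcongr; exact div_le_self hc.le hn
      _ = c * ((1 - 2 * (μ 0 : ℝ))⁻¹ + 1) := by ring
      _ ≤ c * b := by gcongr
  test l hl hln := by linarith [mul_le_mul_of_nonneg_left (hKb l hl hln) hc.le]

lemma Informative.potential_root_le (h : Informative μ 0) (hc : 0 ≤ c) (hb : 0 ≤ b) (hn : 1 ≤ n) :
    c * b * n + targetPotential μ n c (c * b) 0 ≤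
      b * (1 + (Real.exp (logOdds μ 0) - 1)⁻¹) * (c * n) +
        c * Real.log (n / c) / divergence μ 0 + (1 - 2 * (μ 0 : ℝ))⁻¹ * c := by
  have hL := h.logOdds_pos
  have hgap := h.gap_pos.ne'
  have hexp : 0 ≤ (Real.exp (logOdds μ 0) - 1)⁻¹ :=
    inv_nonneg.2 (sub_nonneg.2 (Real.one_le_exp hL.le))
  have hcost : c / divergence μ 0 * (Real.log (n / c) + logOdds μ 0 - 0) =
      c * Real.log (n / c) / divergence μ 0 + (1 - 2 * (μ 0 : ℝ))⁻¹ * c := by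
    rw [divergence]
    field_simp
    ring
  have hexit : c * b * (Real.exp (logOdds μ 0) - 1)⁻¹ * 1 ≤
      c * b * (Real.exp (logOdds μ 0) - 1)⁻¹ * n := by
    gcongr
    exact_mod_cast hn
  rw [targetPotential, hcost, neg_zero, Real.exp_zero, div_eq_mul_inv (c * b)]
  linarith

/-- The price of a step away from the target, relative to `c * n ^ (2 * α)`. -/
def priceFactor (μ : ℕ → unitInterval) (κ p η : ℝ) (A : ℕ) : ℝ :=
  (2 * ruleFactor κ p η A + (1 - 2 * (μ 0 : ℝ))⁻¹ + 1) / (2 * p - 1)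

lemma IsSampleRule.isPrice (hK : IsSampleRule μ p η A n K) (h : HasPolynomialGap μ α κ)
    (hp : 1 / 2 < p) (hp' : p < 1) (hη : 0 < η) (hη' : η < 1) (hc : 0 < c) (hcn : c ≤ n) :
    IsPrice μ n K p c (c * (priceFactor μ κ p η A * (n : ℝ) ^ (2 * α))) := by
  have hinf := h.informative 0
  have hgap := inv_pos.2 hinf.gap_pos
  have hrule := ruleFactor_nonneg (κ := κ) (p := p) (A := A) hη hη'
  have hpos : 0 < 2 * p - 1 := by linarith
  have hmul : priceFactor μ κ p η A * (2 * p - 1) =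
      2 * ruleFactor κ p η A + (1 - 2 * (μ 0 : ℝ))⁻¹ + 1 := div_mul_cancel₀ _ hpos.ne'
  have hpow : (1 : ℝ) ≤ (n : ℝ) ^ (2 * α) :=
    one_le_pow₀ (by exact_mod_cast Nat.cast_pos.1 (hc.trans_le hcn))
  refine hinf.isPrice hc hcn (by linarith) (fun l hl hln => (hK l hl hln).1) ?_ fun l hl hln => ?_
  · have hfactor : (1 - 2 * (μ 0 : ℝ))⁻¹ + 1 ≤ priceFactor μ κ p η A := by
      rw [priceFactor, le_div_iff₀ hpos]
      nlinarith
    exact hfactor.trans (le_mul_of_one_le_right (by linarith) hpow)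
  · calc 2 * (K l : ℝ) ≤ 2 * (ruleFactor κ p η A * (n : ℝ) ^ (2 * α)) := by
          gcongr
          exact hK.le_mul_pow h (by linarith) hp' hη hη' hl hln
      _ = 2 * ruleFactor κ p η A * (n : ℝ) ^ (2 * α) := by ring
      _ ≤ priceFactor μ κ p η A * (2 * p - 1) * (n : ℝ) ^ (2 * α) := by
          rw [hmul]
          gcongr
          linarith
      _ = priceFactor μ κ p η A * (n : ℝ) ^ (2 * α) * (2 * p - 1) := by ring

/-- The factor `B₁` of `c * n ^ (2 * α + 1)` in the bound on the Bayes risk. -/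
def riskFactor (μ : ℕ → unitInterval) (κ p η : ℝ) (A : ℕ) : ℝ :=
  priceFactor μ κ p η A * (1 + (Real.exp (logOdds μ 0) - 1)⁻¹)

theorem IsSampleRule.bayesRisk_le (hK : IsSampleRule μ p η A n K) (h : HasPolynomialGap μ α κ)
    (hp : 1 / 2 < p) (hp' : p < 1) (hη : 0 < η) (hη' : η < 1) (hc : 0 < c) (hcn : c ≤ n)
    (tie : Node n → Bool) (π : PMF (Leaf n)) :
    (irw n μ K tie c).bayesRisk μ π c ≤
      ENNReal.ofReal (riskFactor μ κ p η A * (c * (n : ℝ) ^ (2 * α + 1)) +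
        c * Real.log (n / c) / divergence μ 0 + (1 - 2 * (μ 0 : ℝ))⁻¹ * c) := by
  have hβ := hK.isPrice h hp hp' hη hη' hc hcn
  refine (hβ.bayesRisk_le tie π).trans (ENNReal.ofReal_le_ofReal
    ((hβ.informative.potential_root_le hc.le (nonneg_of_mul_nonneg_right hβ.nonneg hc)
      (Nat.cast_pos.1 (hc.trans_le hcn))).trans_eq ?_))
  rw [riskFactor]
  ring

lemma Strategy.sampleComplexity_le_of_bayesRisk_le {Γ : Strategy n} {π : PMF (Leaf n)} {x : ℝ}
    (hc : 0 < c) (h : Γ.bayesRisk μ π c ≤ ENNReal.ofReal (c * x)) :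
    Γ.sampleComplexity μ π ≤ ENNReal.ofReal x := by
  refine (ENNReal.mul_le_mul_iff_right (ENNReal.ofReal_pos.2 hc).ne' ENNReal.ofReal_ne_top).1 ?_
  rw [← ENNReal.ofReal_mul hc.le]
  exact le_add_self.trans h

lemma risk_bound_le_mul {B₁ B₂ D x N : ℝ} (hc : 0 < c) (hD : 0 < D) (hB₂ : 0 ≤ B₂) (hN : 1 ≤ N)
    (hx : 0 ≤ x) (hxN : x ≤ N) :
    B₁ * (c * N) + c * Real.log (x / c) / D + B₂ * c ≤ c * ((B₁ + (c * D)⁻¹ + B₂) * N) := by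
  have hlog : Real.log (x / c) ≤ N / c := (Real.log_le_self (by positivity)).trans (by gcongr)
  calc B₁ * (c * N) + c * Real.log (x / c) / D + B₂ * c
      ≤ B₁ * (c * N) + c * (N / c) / D + B₂ * (c * N) := by
        gcongr
        exact le_mul_of_one_le_right hc.le hN
    _ = c * ((B₁ + (c * D)⁻¹ + B₂) * N) := by field_simp

theorem IsSampleRule.sampleComplexity_le (hK : IsSampleRule μ p η A n K)
    (h : HasPolynomialGap μ α κ) (hp : 1 / 2 < p) (hp' : p < 1) (hη : 0 < η) (hη' : η < 1)
    (hc : 0 < c) (hcn : c ≤ n) (tie : Node n → Bool) (π : PMF (Leaf n)) :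
    (irw n μ K tie c).sampleComplexity μ π ≤
      ENNReal.ofReal ((riskFactor μ κ p η A + (c * divergence μ 0)⁻¹ + (1 - 2 * (μ 0 : ℝ))⁻¹) *
        (n : ℝ) ^ (2 * α + 1)) := by
  have hinf := h.informative 0
  have hn : (1 : ℝ) ≤ n := by exact_mod_cast Nat.cast_pos.1 (hc.trans_le hcn)
  exact Strategy.sampleComplexity_le_of_bayesRisk_le hc
    ((hK.bayesRisk_le h hp hp' hη hη' hc hcn tie π).trans (ENNReal.ofReal_le_ofReal
      (risk_bound_le_mul hc hinf.divergence_pos (inv_pos.2 hinf.gap_pos).le (one_le_pow₀ hn)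
        n.cast_nonneg (le_self_pow₀ hn (Nat.succ_ne_zero _)))))

end Risk

end TreeSearch

end

theorem theorem2_general {μ : ℕ → unitInterval} {α : ℕ} {κ : ℝ} (h : HasPolynomialGap μ α κ) :
    (∀ p : ℝ, 0 < p → p < 1 → ∀ l : ℕ, MeetsConfidence μ p l (minSampleSize μ p l)) ∧
    (∀ η : ℝ, 0 < η → η < 1 → ∀ l : ℕ,
      MeetsConfidence μ (η ^ 2) l (explicitSampleSize μ η l)) ∧
    ∀ p : ℝ, 1 / 2 < p → p < 1 → ∀ η : ℝ, 0 < η → η < 1 → ∀ A : ℕ,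
      (∃ B₁ B₂ : ℝ, ∀ (n : ℕ) (c : ℝ), 0 < c → c ≤ n →
        ∀ (π : PMF (Leaf n)) (tie : Node n → Bool) (K : ℕ → ℕ), IsSampleRule μ p η A n K →
          (irw n μ K tie c).bayesRisk μ π c ≤
            ENNReal.ofReal
              (B₁ * (c * (n : ℝ) ^ (2 * α + 1)) +
                c * Real.log ((n : ℝ) / c) /
                  (InformationTheory.klDiv (presentLaw μ 0) (absentLaw μ 0)).toReal +
                B₂ * c)) ∧
      (∀ c : ℝ, 0 < c → ∃ C : ℝ, ∀ n : ℕ, c ≤ n →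
        ∀ (π : PMF (Leaf n)) (tie : Node n → Bool) (K : ℕ → ℕ), IsSampleRule μ p η A n K →
          (irw n μ K tie c).sampleComplexity μ π ≤
            ENNReal.ofReal (C * (n : ℝ) ^ (2 * α + 1))) := by
  refine ⟨fun p hp hp' l => (h.informative (l - 1)).meetsConfidence_minSampleSize hp hp',
    fun η hη hη' l => (h.informative (l - 1)).meetsConfidence_explicitSampleSize hη hη',
    fun p hp hp' η hη hη' A => ⟨?_, fun c hc => ?_⟩⟩
  · rw [(h.informative 0).toReal_klDiv]
    exact ⟨_, _, fun n c hc hcn π tie K hK => hK.bayesRisk_le h hp hp' hη hη' hc hcn tie π⟩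
  · exact ⟨_, fun n hcn π tie K hK => hK.sampleComplexity_le h hp hp' hη hη' hc hcn tie π⟩

theorem theorem2 (α : ℕ) (hα : 1 ≤ α) (μ₀ : ℝ) (hμ₀ : 0 < μ₀) (hμ₀' : μ₀ < 1 / 2) :
    -- the least and the closed-form sample sizes have the confidence levels `p` and `η ^ 2`
    (∀ p : ℝ, 1 / 2 < p → p < 1 → ∀ l : ℕ, 1 ≤ l →
      MeetsConfidence (polyNoise α μ₀) p l (minSampleSize (polyNoise α μ₀) p l)) ∧
    (∀ η : ℝ, 1 / Real.sqrt 2 < η → η < 1 → ∀ l : ℕ, 1 ≤ l →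
      MeetsConfidence (polyNoise α μ₀) (η ^ 2) l (explicitSampleSize (polyNoise α μ₀) η l)) ∧
    ∀ p : ℝ, 1 / 2 < p → p < 1 → ∀ η : ℝ, 1 / Real.sqrt 2 < η → η < 1 → ∀ A : ℕ,
      -- the Bayes risk; the depth of the tree is `n = log₂ M`
      (∃ B₁ B₂ : ℝ, ∀ n : ℕ, 1 ≤ n → ∀ c : ℝ, 0 < c → c < 1 →
        ∀ (π : PMF (Leaf n)) (tie : Node n → Bool) (K : ℕ → ℕ),
          IsSampleRule (polyNoise α μ₀) p η A n K →
          (irw n (polyNoise α μ₀) K tie c).bayesRisk (polyNoise α μ₀) π c ≤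
            ENNReal.ofReal
              (B₁ * (c * (n : ℝ) ^ (2 * α + 1)) +
                c * Real.log ((n : ℝ) / c) /
                  (InformationTheory.klDiv (presentLaw (polyNoise α μ₀) 0)
                    (absentLaw (polyNoise α μ₀) 0)).toReal +
                B₂ * c)) ∧
      -- the sample complexity, for a fixed `c`
      (∀ c : ℝ, 0 < c → c < 1 → ∃ C : ℝ, ∀ n : ℕ, 1 ≤ n →
        ∀ (π : PMF (Leaf n)) (tie : Node n → Bool) (K : ℕ → ℕ),
          IsSampleRule (polyNoise α μ₀) p η A n K →
          (irw n (polyNoise α μ₀) K tie c).sampleComplexity (polyNoise α μ₀) π ≤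
            ENNReal.ofReal (C * (n : ℝ) ^ (2 * α + 1))) := by
  obtain ⟨hmin, hex, hirw⟩ := theorem2_general (hasPolynomialGap_polyNoise α hμ₀ hμ₀')
  have hpos {η : ℝ} (hη : 1 / Real.sqrt 2 < η) : 0 < η := lt_trans (by positivity) hη
  have hle {c : ℝ} {n : ℕ} (hc : c < 1) (hn : 1 ≤ n) : c ≤ n := hc.le.trans (by exact_mod_cast hn)
  refine ⟨fun p hp hp' l _ => hmin p (by linarith) hp' l,
    fun η hη hη' l _ => hex η (hpos hη) hη' l, fun p hp hp' η hη hη' A => ?_⟩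
  obtain ⟨⟨B₁, B₂, hB⟩, hC⟩ := hirw p hp hp' η (hpos hη) hη' A
  refine ⟨⟨B₁, B₂, fun n hn c hc hc' => hB n c hc (hle hc' hn)⟩, fun c hc hc' => ?_⟩
  exact (hC c hc).imp fun C hC n hn => hC n (hle hc' hn)
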